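/- Let $F$ be a field and $A$ a simple finite-dimensional associative unital $F$-algebra with centre $Z(A)$, and let $\operatorname{End} A_F$ be the algebra of $F$-linear endomorphisms of $A$. It is a left $A$-bialgebroid with source $s(a)=\lambda_a$ (left multiplication by $a$), target $t(a)=\rho_a$ (right multiplication by $a$), counit $\varepsilon(\alpha)=\alpha(1)$ and coproduct $\Delta(\alpha)=\alpha_{(1)}\otimes_A\alpha_{(2)}$ determined by $\alpha_{(1)}(x)\,\alpha_{(2)}(y)=\alpha(xy)$ for $x,y\in A$. A sub-$A$-bialgebroid of $\operatorname{End} A_F$ is an $F$-subalgebra $W$ that carries a left bialgebroid structure over the same base algebra $A$ for which the inclusion respects source, target, coproduct and counit. (1) The maps $$E\mapsto \operatorname{End} A_E=\{\alpha\in \operatorname{End} A_F : \alpha(xy)=\alpha(x)y \text{ for all } x\in A,\ y\in E\},$$ $$W\mapsto A^W=\{x\in A : \alpha(x)=\alpha(1)x \text{ for all } \alpha\in W\}$$ are mutually inverse, inclusion-reversing bijections between the set of fields $E$ with $F\subseteq E\subseteq Z(A)$ and the set of sub-$A$-bialgebroids $W$ of $\operatorname{End} A_F$. Moreover $\operatorname{End}_W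 A=\{\lambda_x : x\in A^W\}$, where $\operatorname{End}_W A$ is the centralizer of $W$ in $\operatorname{End} A_F$. (2) Suppose that $A$ is a separable $F$-algebra, i.e. there is $e\in A\otimes_F A$ with $ae=ea$ for all $a\in A$ and with product $1$. Then there are an $F$-linear functional $\varphi:A\to F$ and $x_1,y_1,\dots,x_n,y_n\in A$ with $\sum_i\varphi(ax_i)y_i=a=\sum_i x_i\varphi(y_ia)$ for all $a\in A$ and $\sum_i x_iy_i=1$. For every such system, $\operatorname{End} A_F$ is a weak Hopf algebra over $F$ with coproduct $\alpha\mapsto\sum_i t(x_i)\alpha_{(1)}\otimes_F s(y_i)\alpha_{(2)}$, counit $\alpha\mapsto\varphi(\alpha(1))$ and antipode $S(\alpha)(a)=\sum_i\varphi(\alpha(y_i)a)\,x_i$, and the maps $E\mapsto\operatorname{End} A_E$ and $W\mapsto A^W$ are mutually inverse, inclusion-reversing bijections between the set of fields $E$ with $F\subseteq E\subseteq Z(A)$ and the set of weak Hopf subalgebras $W$ of $\operatorname{End} A_F$ (unital subalgebras $W$ with $\Delta(W)\subseteq W\otimes_F W$ and $S(W)\subseteq W$). Again $\operatorname{End}_W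 A=\{\lambda_x : x\in A^W\}$. -/

import Mathlib

open scoped TensorProduct

/-! ## Left bialgebroids over a noncommutative base algebra -/

section Bialgebroid

variable {F A H : Type*} [Field F] [Ring A] [Algebra F A] [Ring H] [Algebra F H]

/-- The relations `h t(a) ⊗ h' = h ⊗ a h'` that turn `H ⊗[F] H` into `H ⊗_A H`, where `H` is the
`A`-bimodule `a · h · b = s(a) t(b) h`: the `F`-span of all `t(a) h ⊗ h' - h ⊗ s(a) h'`. -/
def balancedRel (s : A →ₐ[F] H) (t : Aᵐᵒᵖ →ₐ[F] H) : Submodule F (H ⊗[F] H) :=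
  Submodule.span F {Z | ∃ (a : A) (h h' : H),
    Z = (t (MulOpposite.op a) * h) ⊗ₜ[F] h' - h ⊗ₜ[F] (s a * h')}

/-- The tensor product `H ⊗_A H` over the (noncommutative) base algebra `A`. -/
abbrev TensorOver (s : A →ₐ[F] H) (t : Aᵐᵒᵖ →ₐ[F] H) : Type _ :=
  (H ⊗[F] H) ⧸ balancedRel s t

/-- The relations that turn `H ⊗[F] (H ⊗[F] H)` into `H ⊗_A H ⊗_A H`. -/
def balancedRel₃ (s : A →ₐ[F] H) (t : Aᵐᵒᵖ →ₐ[F] H) : Submodule F (H ⊗[F] (H ⊗[F] H)) :=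
  Submodule.span F
    ({Z | ∃ (a : A) (h h' h'' : H), Z = (t (MulOpposite.op a) * h) ⊗ₜ[F] (h' ⊗ₜ[F] h'')
        - h ⊗ₜ[F] ((s a * h') ⊗ₜ[F] h'')} ∪
     {Z | ∃ (a : A) (h h' h'' : H), Z = h ⊗ₜ[F] ((t (MulOpposite.op a) * h') ⊗ₜ[F] h'')
        - h ⊗ₜ[F] (h' ⊗ₜ[F] (s a * h''))})

/-- A left bialgebroid with total `F`-algebra `H` and base `F`-algebra `A`.
In the axioms, `X : H ⊗[F] H` runs over the representatives of `Δ(h) ∈ H ⊗_A H`, so that `X`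
plays the role of `h₍₁₎ ⊗ h₍₂₎`; the axioms do not depend on the representative. -/
structure LeftBialgebroid (F A H : Type*) [Field F] [Ring A] [Algebra F A]
    [Ring H] [Algebra F H] where
  /-- The source map. -/
  source : A →ₐ[F] H
  /-- The target map. -/
  target : Aᵐᵒᵖ →ₐ[F] H
  /-- The coproduct `Δ : H → H ⊗_A H`. -/
  comul : H →ₗ[F] TensorOver source target
  /-- The counit `ε : H → A`. -/
  counit : H →ₗ[F] A
  source_target_comm : ∀ (a : A) (b : Aᵐᵒᵖ), Commute (source a) (target b)
  /-- `Δ` is a map of `A`-bimodules. -/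
  comul_bimodule : ∀ (a : A) (b : Aᵐᵒᵖ) (h : H) (X : H ⊗[F] H),
    (balancedRel source target).mkQ X = comul h →
    comul (source a * target b * h) =
      (balancedRel source target).mkQ ((source a ⊗ₜ[F] target b) * X)
  /-- `ε` is a map of `A`-bimodules. -/
  counit_bimodule : ∀ (a b : A) (h : H),
    counit (source a * target (MulOpposite.op b) * h) = a * counit h * b
  /-- Coassociativity in `H ⊗_A H ⊗_A H`, computed with any linear lift `D` of `Δ`. -/
  coassoc : ∀ D : H →ₗ[F] H ⊗[F] H,
    (∀ h, (balancedRel source target).mkQ (D h) = comul h) →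
    ∀ h, (balancedRel₃ source target).mkQ (TensorProduct.assoc F H H H (D.rTensor H (D h))) =
      (balancedRel₃ source target).mkQ (D.lTensor H (D h))
  /-- `s(ε(h₍₁₎)) h₍₂₎ = h`. -/
  counit_left : ∀ (h : H) (X : H ⊗[F] H), (balancedRel source target).mkQ X = comul h →
    LinearMap.mul' F H ((source.toLinearMap ∘ₗ counit).rTensor H X) = h
  /-- `t(ε(h₍₂₎)) h₍₁₎ = h`. -/
  counit_right : ∀ (h : H) (X : H ⊗[F] H), (balancedRel source target).mkQ X = comul h →
    LinearMap.mul' F H (TensorProduct.comm F H H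
      ((target.toLinearMap ∘ₗ (MulOpposite.opLinearEquiv F).toLinearMap ∘ₗ counit).lTensor H X))
      = h
  /-- Takeuchi's condition `h₍₁₎ t(a) ⊗ h₍₂₎ = h₍₁₎ ⊗ h₍₂₎ s(a)`. -/
  takeuchi : ∀ (a : A) (h : H) (X : H ⊗[F] H), (balancedRel source target).mkQ X = comul h →
    (balancedRel source target).mkQ (X * (target (MulOpposite.op a) ⊗ₜ[F] 1)) =
      (balancedRel source target).mkQ (X * (1 ⊗ₜ[F] source a))
  comul_one : comul 1 = (balancedRel source target).mkQ (1 ⊗ₜ[F] 1)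
  comul_mul : ∀ (g h : H) (X Y : H ⊗[F] H), (balancedRel source target).mkQ X = comul g →
    (balancedRel source target).mkQ Y = comul h →
    comul (g * h) = (balancedRel source target).mkQ (X * Y)
  counit_one : counit 1 = 1
  counit_mul_source : ∀ g h : H, counit (g * source (counit h)) = counit (g * h)
  counit_mul_target : ∀ g h : H,
    counit (g * target (MulOpposite.op (counit h))) = counit (g * h)

/-- A sub-`A`-bialgebroid: a subalgebra `W` of the total algebra that carries a left bialgebroid
structure over the same base algebra `A` for which the inclusion `W → H` respects source, target,
coproduct and counit. In particular `s(A), t(A) ⊆ W`, and `W` is a sub-`A`-coring. -/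
def LeftBialgebroid.IsSubBialgebroid (B : LeftBialgebroid F A H) (W : Subalgebra F H) : Prop :=
  ∃ B' : LeftBialgebroid F A W,
    (∀ a, (B'.source a : H) = B.source a) ∧
    (∀ a, (B'.target a : H) = B.target a) ∧
    (∀ (w : W) (X : W ⊗[F] W), (balancedRel B'.source B'.target).mkQ X = B'.comul w →
      (balancedRel B.source B.target).mkQ
        (TensorProduct.map W.val.toLinearMap W.val.toLinearMap X) = B.comul (w : H)) ∧
    (∀ w : W, B'.counit w = B.counit (w : H))

end Bialgebroid

/-! ## The bialgebroid of linear endomorphisms -/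

section EndBialgebroid

variable {F A H : Type*} [Field F] [Ring A] [Algebra F A] [Ring H] [Algebra F H]

/-- `h ⊗ h' ↦ h(x) h'(y)`, for an algebra `H` acting on `A` through `ι`. -/
noncomputable def evalTwo (ι : H →ₐ[F] Module.End F A) (x y : A) : H ⊗[F] H →ₗ[F] A :=
  LinearMap.mul' F A ∘ₗ TensorProduct.map
    (LinearMap.applyₗ x ∘ₗ ι.toLinearMap) (LinearMap.applyₗ y ∘ₗ ι.toLinearMap)

@[simp] theorem evalTwo_tmul (ι : H →ₐ[F] Module.End F A) (x y : A) (h h' : H) :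
    evalTwo ι x y (h ⊗ₜ[F] h') = ι h x * ι h' y := by
  simp [evalTwo]

/-- `h ⊗ h' ⊗ h'' ↦ h(x) h'(y) h''(z)`. -/
noncomputable def evalThree (ι : H →ₐ[F] Module.End F A) (x y z : A) :
    H ⊗[F] (H ⊗[F] H) →ₗ[F] A :=
  LinearMap.mul' F A ∘ₗ TensorProduct.map
    (LinearMap.applyₗ x ∘ₗ ι.toLinearMap) (evalTwo ι y z)

@[simp] theorem evalThree_tmul (ι : H →ₐ[F] Module.End F A) (x y z : A) (h : H) (X : H ⊗[F] H) :
    evalThree ι x y z (h ⊗ₜ[F] X) = ι h x * evalTwo ι y z X := by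
  simp [evalThree]

/-- An algebra `H` of linear endomorphisms of `A` that contains the left multiplications `s(a)`
and the right multiplications `t(a)`, together with a right depth two quasibasis
`γ k ∈ H`, `u k ∈ A`: every `h ∈ H` is `∑ k, t(h(u k)) γ k`. -/
structure IsQuasibasis (ι : H →ₐ[F] Module.End F A) (s : A →ₐ[F] H) (t : Aᵐᵒᵖ →ₐ[F] H)
    {n : ℕ} (γ : Fin n → H) (u : Fin n → A) : Prop where
  inj : Function.Injective ι
  source_apply : ∀ a x : A, ι (s a) x = a * x
  target_apply : ∀ a x : A, ι (t (MulOpposite.op a)) x = x * a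
  expand : ∀ h : H, ∑ k, t (MulOpposite.op (ι h (u k))) * γ k = h

namespace IsQuasibasis

variable {ι : H →ₐ[F] Module.End F A} {s : A →ₐ[F] H} {t : Aᵐᵒᵖ →ₐ[F] H}
  {n : ℕ} {γ : Fin n → H} {u : Fin n → A}

theorem ext (Q : IsQuasibasis ι s t γ u) {g h : H} (e : ∀ x, ι g x = ι h x) : g = h :=
  Q.inj (LinearMap.ext e)

theorem evalTwo_of_mem (Q : IsQuasibasis ι s t γ u) {X : H ⊗[F] H}
    (hX : X ∈ balancedRel s t) (x y : A) : evalTwo ι x y X = 0 := by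
  have : balancedRel s t ≤ LinearMap.ker (evalTwo ι x y) := by
    refine Submodule.span_le.2 ?_
    rintro _ ⟨a, h, h', rfl⟩
    simp [Q.source_apply, Q.target_apply, mul_assoc]
  exact this hX

theorem mem_of_evalTwo (Q : IsQuasibasis ι s t γ u) {X : H ⊗[F] H}
    (hX : ∀ x y, evalTwo ι x y X = 0) : X ∈ balancedRel s t := by
  let c : A → (H ⊗[F] H →ₗ[F] H) := fun v => LinearMap.mul' F H ∘ₗ
    ((s.toLinearMap ∘ₗ LinearMap.applyₗ v ∘ₗ ι.toLinearMap).rTensor H)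
  have hc : ∀ v y (Y : H ⊗[F] H), ι (c v Y) y = evalTwo ι v y Y := by
    intro v y Y
    induction Y using TensorProduct.induction_on with
    | zero => simp
    | tmul h h' => simp [c, Q.source_apply]
    | add Y Z hY hZ => simp [hY, hZ]
  have key : ∀ Y : H ⊗[F] H, Y - ∑ k, γ k ⊗ₜ[F] c (u k) Y ∈ balancedRel s t := by
    intro Y
    induction Y using TensorProduct.induction_on with
    | zero => simp
    | tmul h h' =>
      have : h ⊗ₜ[F] h' - ∑ k, γ k ⊗ₜ[F] c (u k) (h ⊗ₜ[F] h')
          = ∑ k, ((t (MulOpposite.op (ι h (u k))) * γ k) ⊗ₜ[F] h'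
            - γ k ⊗ₜ[F] (s (ι h (u k)) * h')) := by
        rw [Finset.sum_sub_distrib, ← TensorProduct.sum_tmul, Q.expand]
        simp [c]
      rw [this]
      exact Submodule.sum_mem _ fun k _ => Submodule.subset_span ⟨_, _, _, rfl⟩
    | add Y Z hY hZ =>
      have := add_mem hY hZ
      simp only [map_add, TensorProduct.tmul_add, Finset.sum_add_distrib]
      rwa [add_sub_add_comm]
  have h0 : ∀ v, c v X = 0 := fun v => Q.ext fun y => by simp [hc, hX]
  simpa [h0] using key X

theorem mk_eq_iff (Q : IsQuasibasis ι s t γ u) {X Y : H ⊗[F] H} :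
    (balancedRel s t).mkQ X = (balancedRel s t).mkQ Y ↔
      ∀ x y, evalTwo ι x y X = evalTwo ι x y Y := by
  rw [Submodule.mkQ_apply, Submodule.mkQ_apply, Submodule.Quotient.eq]
  constructor
  · intro h x y
    have := Q.evalTwo_of_mem h x y
    rwa [map_sub, sub_eq_zero] at this
  · intro h
    exact Q.mem_of_evalTwo fun x y => by rw [map_sub, h, sub_self]

theorem mk₃_eq (Q : IsQuasibasis ι s t γ u) {X Y : H ⊗[F] (H ⊗[F] H)}
    (h : ∀ x y z, evalThree ι x y z X = evalThree ι x y z Y) :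
    (balancedRel₃ s t).mkQ X = (balancedRel₃ s t).mkQ Y := by
  rw [Submodule.mkQ_apply, Submodule.mkQ_apply, Submodule.Quotient.eq]
  let c : A → (H ⊗[F] (H ⊗[F] H) →ₗ[F] H ⊗[F] H) := fun v =>
    LinearMap.mul' F (H ⊗[F] H) ∘ₗ (((TensorProduct.mk F H H).flip 1 ∘ₗ s.toLinearMap ∘ₗ
      LinearMap.applyₗ v ∘ₗ ι.toLinearMap).rTensor (H ⊗[F] H))
  have hs : ∀ a y z (Y : H ⊗[F] H),
      evalTwo ι y z ((s a ⊗ₜ[F] 1) * Y) = a * evalTwo ι y z Y := by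
    intro a y z Y
    induction Y using TensorProduct.induction_on with
    | zero => simp
    | tmul h h' => simp [Q.source_apply, mul_assoc]
    | add Y Z hY hZ => simp [mul_add, hY, hZ]
  have hc : ∀ v y z (Y : H ⊗[F] (H ⊗[F] H)),
      evalTwo ι y z (c v Y) = evalThree ι v y z Y := by
    intro v y z Y
    induction Y using TensorProduct.induction_on with
    | zero => simp
    | tmul h h' => simp [c, hs]
    | add Y Z hY hZ => simp [hY, hZ]
  have key : ∀ Y : H ⊗[F] (H ⊗[F] H),
      Y - ∑ k, γ k ⊗ₜ[F] c (u k) Y ∈ balancedRel₃ s t := by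
    intro Y
    induction Y using TensorProduct.induction_on with
    | zero => simp
    | tmul h Z =>
      induction Z using TensorProduct.induction_on with
      | zero => simp
      | tmul h' h'' =>
        have : h ⊗ₜ[F] (h' ⊗ₜ[F] h'') - ∑ k, γ k ⊗ₜ[F] c (u k) (h ⊗ₜ[F] (h' ⊗ₜ[F] h''))
            = ∑ k, ((t (MulOpposite.op (ι h (u k))) * γ k) ⊗ₜ[F] (h' ⊗ₜ[F] h'')
              - γ k ⊗ₜ[F] ((s (ι h (u k)) * h') ⊗ₜ[F] h'')) := by
          rw [Finset.sum_sub_distrib, ← TensorProduct.sum_tmul, Q.expand]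
          simp [c]
        rw [this]
        exact Submodule.sum_mem _ fun k _ =>
          Submodule.subset_span (Or.inl ⟨_, _, _, _, rfl⟩)
      | add Y Z hY hZ =>
        have := add_mem hY hZ
        simp only [map_add, TensorProduct.tmul_add, Finset.sum_add_distrib]
        rwa [add_sub_add_comm]
    | add Y Z hY hZ =>
      have := add_mem hY hZ
      simp only [map_add, TensorProduct.tmul_add, Finset.sum_add_distrib]
      rwa [add_sub_add_comm]
  have hmem : ∀ (g : H) (Z : H ⊗[F] H), Z ∈ balancedRel s t →
      g ⊗ₜ[F] Z ∈ balancedRel₃ s t := by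
    intro g Z hZ
    have : balancedRel s t ≤ (balancedRel₃ s t).comap (TensorProduct.mk F H (H ⊗[F] H) g) := by
      refine Submodule.span_le.2 ?_
      rintro _ ⟨a, h, h', rfl⟩
      refine Submodule.subset_span (Or.inr ⟨a, g, h, h', ?_⟩)
      simp [TensorProduct.tmul_sub]
    exact this hZ
  have h1 := key (X - Y)
  have h2 : ∑ k, γ k ⊗ₜ[F] c (u k) (X - Y) ∈ balancedRel₃ s t := by
    refine Submodule.sum_mem _ fun k _ => hmem _ _ (Q.mem_of_evalTwo fun y z => ?_)
    rw [hc, map_sub, h, sub_self]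
  simpa using add_mem h1 h2

/-- The coproduct `Δ(h) = ∑ k, γ k ⊗ h (u k · -)`. -/
noncomputable def comul (_ : IsQuasibasis ι s t γ u) : H →ₗ[F] TensorOver s t :=
  (balancedRel s t).mkQ ∘ₗ
    ∑ k, TensorProduct.mk F H H (γ k) ∘ₗ LinearMap.mulRight F (s (u k))

/-- `Δ(h)` is the element of `H ⊗_A H` that represents `x ⊗ y ↦ h(x y)`. -/
theorem mk_eq_comul_iff (Q : IsQuasibasis ι s t γ u) {X : H ⊗[F] H} {h : H} :
    (balancedRel s t).mkQ X = Q.comul h ↔ ∀ x y, evalTwo ι x y X = ι h (x * y) := by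
  rw [comul, LinearMap.comp_apply, Q.mk_eq_iff]
  refine forall₂_congr fun x y => ?_
  have h2 : ∑ k, ι (t (MulOpposite.op (ι (h * t (MulOpposite.op y)) (u k))) * γ k) x
      = ι (h * t (MulOpposite.op y)) x := by
    rw [← LinearMap.sum_apply, ← map_sum, Q.expand]
  have : evalTwo ι x y ((∑ k, TensorProduct.mk F H H (γ k) ∘ₗ
      LinearMap.mulRight F (s (u k))) h) = ι h (x * y) := by
    simpa [Q.source_apply, Q.target_apply] using h2
  rw [this]

/-- The left bialgebroid over `A` of an algebra of linear endomorphisms of `A` with a right depth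
two quasibasis: `s(a)` and `t(a)` are the left and right multiplications,
`Δ(h) = ∑ k, γ k ⊗ h (u k · -)` and `ε(h) = h(1)`. -/
noncomputable def bialgebroid (Q : IsQuasibasis ι s t γ u) : LeftBialgebroid F A H where
  source := s
  target := t
  comul := Q.comul
  counit := LinearMap.applyₗ (1 : A) ∘ₗ ι.toLinearMap
  source_target_comm a b := by
    refine Q.ext fun x => ?_
    induction b using MulOpposite.rec'
    simp [Q.source_apply, Q.target_apply, mul_assoc]
  comul_bimodule a b h X hX := by
    rw [Q.mk_eq_comul_iff] at hX
    symm
    rw [Q.mk_eq_comul_iff]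
    intro x y
    induction b using MulOpposite.rec' with | _ b => ?_
    have : ∀ Y : H ⊗[F] H, evalTwo ι x y ((s a ⊗ₜ[F] t (MulOpposite.op b)) * Y)
        = a * evalTwo ι x y Y * b := by
      intro Y
      induction Y using TensorProduct.induction_on with
      | zero => simp
      | tmul h h' => simp [Q.source_apply, Q.target_apply, mul_assoc]
      | add Y Z hY hZ => simp [mul_add, add_mul, hY, hZ]
    simp [this, hX, Q.source_apply, Q.target_apply, mul_assoc]
  counit_bimodule a b h := by
    simp [Q.source_apply, Q.target_apply, mul_assoc]
  coassoc D hD h := by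
    have hD' := fun g => Q.mk_eq_comul_iff.1 (hD g)
    refine Q.mk₃_eq fun x y z => ?_
    have h1 : ∀ Y : H ⊗[F] H, evalThree ι x y z (TensorProduct.assoc F H H H (D.rTensor H Y))
        = evalTwo ι (x * y) z Y := by
      intro Y
      induction Y using TensorProduct.induction_on with
      | zero => simp
      | tmul g g' =>
        have : ∀ Z : H ⊗[F] H, evalThree ι x y z (TensorProduct.assoc F H H H (Z ⊗ₜ[F] g'))
            = evalTwo ι x y Z * ι g' z := by
          intro Z
          induction Z using TensorProduct.induction_on with
          | zero => simp
          | tmul k k' => simp [mul_assoc]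
          | add Y Z hY hZ => simp [TensorProduct.add_tmul, add_mul, hY, hZ]
        simp [this, hD']
      | add Y Z hY hZ => simp only [map_add, hY, hZ]
    have h2 : ∀ Y : H ⊗[F] H, evalThree ι x y z (D.lTensor H Y) = evalTwo ι x (y * z) Y := by
      intro Y
      induction Y using TensorProduct.induction_on with
      | zero => simp
      | tmul g g' => simp [hD']
      | add Y Z hY hZ => simp only [map_add, hY, hZ]
    rw [h1, h2, hD', hD', mul_assoc]
  counit_left h X hX := by
    rw [Q.mk_eq_comul_iff] at hX
    refine Q.ext fun y => ?_
    have : ∀ Y : H ⊗[F] H, ι (LinearMap.mul' F H ((s.toLinearMap ∘ₗ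
        (LinearMap.applyₗ (1 : A) ∘ₗ ι.toLinearMap)).rTensor H Y)) y = evalTwo ι 1 y Y := by
      intro Y
      induction Y using TensorProduct.induction_on with
      | zero => simp
      | tmul g g' => simp [Q.source_apply]
      | add Y Z hY hZ => simp only [map_add, LinearMap.add_apply, hY, hZ]
    rw [this, hX, one_mul]
  counit_right h X hX := by
    rw [Q.mk_eq_comul_iff] at hX
    refine Q.ext fun y => ?_
    have : ∀ Y : H ⊗[F] H, ι (LinearMap.mul' F H (TensorProduct.comm F H H
        ((t.toLinearMap ∘ₗ (MulOpposite.opLinearEquiv F).toLinearMap ∘ₗ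
        (LinearMap.applyₗ (1 : A) ∘ₗ ι.toLinearMap)).lTensor H Y))) y = evalTwo ι y 1 Y := by
      intro Y
      induction Y using TensorProduct.induction_on with
      | zero => simp
      | tmul g g' => simp [Q.target_apply]
      | add Y Z hY hZ => simp only [map_add, LinearMap.add_apply, hY, hZ]
    rw [this, hX, mul_one]
  takeuchi a h X hX := by
    rw [Q.mk_eq_comul_iff] at hX
    rw [Q.mk_eq_iff]
    intro x y
    have h1 : ∀ Y : H ⊗[F] H, evalTwo ι x y (Y * (t (MulOpposite.op a) ⊗ₜ[F] 1))
        = evalTwo ι (x * a) y Y := by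
      intro Y
      induction Y using TensorProduct.induction_on with
      | zero => simp
      | tmul g g' => simp [Q.target_apply]
      | add Y Z hY hZ => simp only [add_mul, map_add, hY, hZ]
    have h2 : ∀ Y : H ⊗[F] H, evalTwo ι x y (Y * (1 ⊗ₜ[F] s a)) = evalTwo ι x (a * y) Y := by
      intro Y
      induction Y using TensorProduct.induction_on with
      | zero => simp
      | tmul g g' => simp [Q.source_apply]
      | add Y Z hY hZ => simp only [add_mul, map_add, hY, hZ]
    rw [h1, h2, hX, hX, mul_assoc]
  comul_one := by
    symm
    rw [Q.mk_eq_comul_iff]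
    simp
  comul_mul g h X Y hX hY := by
    rw [Q.mk_eq_comul_iff] at hX hY
    symm
    rw [Q.mk_eq_comul_iff]
    intro x y
    have : ∀ Z : H ⊗[F] H, evalTwo ι x y (X * Z) = ι g (evalTwo ι x y Z) := by
      intro Z
      induction Z using TensorProduct.induction_on with
      | zero => simp
      | tmul k k' =>
        have : ∀ V : H ⊗[F] H, evalTwo ι x y (V * (k ⊗ₜ[F] k'))
            = evalTwo ι (ι k x) (ι k' y) V := by
          intro V
          induction V using TensorProduct.induction_on with
          | zero => simp
          | tmul l l' => simp
          | add Y Z hY hZ => simp only [add_mul, map_add, hY, hZ]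
        rw [this, hX, evalTwo_tmul]
      | add Y Z hY hZ => simp only [mul_add, map_add, hY, hZ]
    rw [this, hY, map_mul ι]
    rfl
  counit_one := by simp
  counit_mul_source g h := by simp [Q.source_apply]
  counit_mul_target g h := by simp [Q.target_apply]

end IsQuasibasis

/-- The coordinate functionals of a basis form a right depth two quasibasis of `End A_F`. -/
theorem isQuasibasis_end (F A : Type*) [Field F] [Ring A] [Algebra F A] [Module.Finite F A] :
    IsQuasibasis (AlgHom.id F (Module.End F A)) (Algebra.lmul F A) (Algebra.lsmul F F A)
      (fun k => ((Module.finBasis F A).coord k).smulRight (1 : A))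
      (fun k => Module.finBasis F A k) where
  inj := Function.injective_id
  source_apply _ _ := rfl
  target_apply _ _ := rfl
  expand h := by
    ext x
    conv_rhs => rw [← (Module.finBasis F A).sum_repr x, map_sum]
    simp

/-- The left `A`-bialgebroid `End A_F` of all `F`-linear endomorphisms of `A`. Source and target
are the left and right multiplications, `Δ(α) = ∑ k, b*_k(-) 1 ⊗ α(b_k · -)` for a basis `b`
of `A` over `F`, i.e. `α₍₁₎(x) α₍₂₎(y) = α(x y)`, and `ε(α) = α(1)`. -/
noncomputable def endBialgebroid (F A : Type*) [Field F] [Ring A] [Algebra F A]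
    [Module.Finite F A] : LeftBialgebroid F A (Module.End F A) :=
  (isQuasibasis_end F A).bialgebroid

end EndBialgebroid

/-! ## Weak Hopf algebras -/

section WeakHopf

/-- A weak Hopf algebra over the field `F`: an algebra and coalgebra with multiplicative coproduct,
weak unit and counit axioms, and an antipode. -/
structure WeakHopfAlgebra (F H : Type*) [Field F] [Ring H] [Algebra F H]
    extends Coalgebra F H where
  /-- The antipode. -/
  antipode : H →ₗ[F] H
  comul_mul : ∀ x y : H, comul (x * y) = comul x * comul y
  /-- `Δ²(1) = (1 ⊗ Δ(1)) (Δ(1) ⊗ 1)`. -/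
  comul_one_left : comul.lTensor H (comul 1) =
    ((1 : H) ⊗ₜ[F] comul 1) * TensorProduct.assoc F H H H (comul 1 ⊗ₜ[F] (1 : H))
  /-- `Δ²(1) = (Δ(1) ⊗ 1) (1 ⊗ Δ(1))`. -/
  comul_one_right : comul.lTensor H (comul 1) =
    TensorProduct.assoc F H H H (comul 1 ⊗ₜ[F] (1 : H)) * ((1 : H) ⊗ₜ[F] comul 1)
  /-- `ε(x y z) = ε(x y₍₁₎) ε(y₍₂₎ z)`. -/
  counit_mul_left : ∀ x y z : H, counit (x * y * z) =
    LinearMap.mul' F F (TensorProduct.map (counit ∘ₗ LinearMap.mulLeft F x)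
      (counit ∘ₗ LinearMap.mulRight F z) (comul y))
  /-- `ε(x y z) = ε(x y₍₂₎) ε(y₍₁₎ z)`. -/
  counit_mul_right : ∀ x y z : H, counit (x * y * z) =
    LinearMap.mul' F F (TensorProduct.map (counit ∘ₗ LinearMap.mulRight F z)
      (counit ∘ₗ LinearMap.mulLeft F x) (comul y))
  /-- `x₍₁₎ S(x₍₂₎) = ε(1₍₁₎ x) 1₍₂₎`. -/
  mul_antipode : ∀ x : H, LinearMap.mul' F H (antipode.lTensor H (comul x)) =
    TensorProduct.lid F H ((counit ∘ₗ LinearMap.mulRight F x).rTensor H (comul 1))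
  /-- `S(x₍₁₎) x₍₂₎ = 1₍₁₎ ε(x 1₍₂₎)`. -/
  antipode_mul : ∀ x : H, LinearMap.mul' F H (antipode.rTensor H (comul x)) =
    TensorProduct.rid F H ((counit ∘ₗ LinearMap.mulLeft F x).lTensor H (comul 1))
  /-- `S(x₍₁₎) x₍₂₎ S(x₍₃₎) = S(x)`. -/
  antipode_mul_antipode : ∀ x : H, LinearMap.mul' F H (TensorProduct.map antipode
    (LinearMap.mul' F H ∘ₗ antipode.lTensor H ∘ₗ comul) (comul x)) = antipode x

/-- A weak Hopf subalgebra: a (unital) subalgebra that is a subcoalgebra, `Δ(W) ⊆ W ⊗ W`, and is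
stable under the antipode. -/
def WeakHopfAlgebra.IsWeakHopfSubalgebra {F H : Type*} [Field F] [Ring H] [Algebra F H]
    (K : WeakHopfAlgebra F H) (W : Subalgebra F H) : Prop :=
  ∀ w ∈ W,
    K.comul w ∈ LinearMap.range
      (TensorProduct.map W.val.toLinearMap W.val.toLinearMap : W ⊗[F] W →ₗ[F] H ⊗[F] H) ∧
    K.antipode w ∈ W

/-- `A` is a separable `F`-algebra: there is a separability idempotent `e ∈ A ⊗ A`, that is,
`a e = e a` for all `a`, and the multiplication sends `e` to `1`. -/
def IsSeparableAlgebra (F A : Type*) [Field F] [Ring A] [Algebra F A] : Prop :=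
  ∃ e : A ⊗[F] A, (∀ a : A, (LinearMap.mulLeft F a).rTensor A e =
    (LinearMap.mulRight F a).lTensor A e) ∧ LinearMap.mul' F A e = 1

/-- A Frobenius system `(φ, x i, y i)` of the `F`-algebra `A` whose dual bases tensor
`∑ i, x i ⊗ y i` is moreover a separability idempotent. -/
structure SeparableFrobeniusSystem (F A : Type*) [Field F] [Ring A] [Algebra F A] where
  /-- The number of pairs in the dual bases. -/
  n : ℕ
  /-- The Frobenius functional. -/
  φ : A →ₗ[F] F
  /-- The first of the dual bases. -/
  x : Fin n → A
  /-- The second of the dual bases. -/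
  y : Fin n → A
  sum_left : ∀ a : A, ∑ i, φ (a * x i) • y i = a
  sum_right : ∀ a : A, ∑ i, φ (y i * a) • x i = a
  sum_mul : ∑ i, x i * y i = 1

namespace SeparableFrobeniusSystem

variable {F A H : Type*} [Field F] [Ring A] [Algebra F A] [Ring H] [Algebra F H]

theorem casimir (S : SeparableFrobeniusSystem F A) (a : A) :
    ∑ i, (a * S.x i) ⊗ₜ[F] S.y i = ∑ i, S.x i ⊗ₜ[F] (S.y i * a) := by
  have h1 : ∀ i, (a * S.x i) ⊗ₜ[F] S.y i =
      ∑ j, S.x j ⊗ₜ[F] (S.φ (S.y j * a * S.x i) • S.y i) := by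
    intro i
    conv_lhs => rw [← S.sum_right (a * S.x i)]
    simp [TensorProduct.sum_tmul, TensorProduct.smul_tmul, mul_assoc]
  simp_rw [h1]
  rw [Finset.sum_comm]
  simp_rw [← TensorProduct.tmul_sum, S.sum_left]

/-- The embedding `h ⊗_A h' ↦ ∑ i, t(x i) h ⊗ s(y i) h'` of `H ⊗_A H` into `H ⊗[F] H`, which
splits the canonical projection. -/
noncomputable def split (S : SeparableFrobeniusSystem F A) (B : LeftBialgebroid F A H) :
    TensorOver B.source B.target →ₗ[F] H ⊗[F] H :=
  (balancedRel B.source B.target).liftQ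
    (LinearMap.mulLeft F (∑ i, B.target (MulOpposite.op (S.x i)) ⊗ₜ[F] B.source (S.y i))) <| by
    refine Submodule.span_le.2 ?_
    rintro _ ⟨a, h, h', rfl⟩
    have := congrArg (fun Z => TensorProduct.map
      (LinearMap.mulRight F h ∘ₗ B.target.toLinearMap ∘ₗ (MulOpposite.opLinearEquiv F).toLinearMap)
      (LinearMap.mulRight F h' ∘ₗ B.source.toLinearMap) Z) (S.casimir a)
    simp only [map_sum, TensorProduct.map_tmul, LinearMap.comp_apply] at this
    simp only [SetLike.mem_coe, LinearMap.mem_ker, map_sub, LinearMap.mulLeft_apply,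
      Finset.sum_mul, Algebra.TensorProduct.tmul_mul_tmul, sub_eq_zero]
    simpa [mul_assoc] using this

/-- `σ(a) = ∑ i, a x i ⊗ y i`. -/
noncomputable def sigma (S : SeparableFrobeniusSystem F A) : A →ₗ[F] A ⊗[F] A :=
  ∑ i, (TensorProduct.mk F A A).flip (S.y i) ∘ₗ LinearMap.mulRight F (S.x i)

theorem sigma_apply (S : SeparableFrobeniusSystem F A) (a : A) :
    S.sigma a = ∑ i, (a * S.x i) ⊗ₜ[F] S.y i := by
  simp [sigma]

theorem sigma_apply' (S : SeparableFrobeniusSystem F A) (a : A) :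
    S.sigma a = ∑ i, S.x i ⊗ₜ[F] (S.y i * a) := by
  rw [sigma_apply, casimir]

theorem sigma_coassoc (S : SeparableFrobeniusSystem F A) (a : A) :
    TensorProduct.assoc F A A A (S.sigma.rTensor A (S.sigma a)) =
      S.sigma.lTensor A (S.sigma a) := by
  conv_rhs => rw [sigma_apply']
  rw [sigma_apply]
  simp only [map_sum, LinearMap.rTensor_tmul, LinearMap.lTensor_tmul]
  simp_rw [sigma_apply' S (a * _), sigma_apply S (_ * a)]
  simp only [TensorProduct.sum_tmul, TensorProduct.tmul_sum, map_sum, TensorProduct.assoc_tmul]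
  rw [Finset.sum_comm]
  simp only [mul_assoc]

theorem mul_sigma (S : SeparableFrobeniusSystem F A) (a : A) :
    LinearMap.mul' F A (S.sigma a) = a := by
  have : ∑ i, a * (S.x i * S.y i) = a := by rw [← Finset.mul_sum, S.sum_mul, mul_one]
  simpa [sigma_apply, mul_assoc] using this

theorem sigma_mul_right (S : SeparableFrobeniusSystem F A) (a b : A) :
    (LinearMap.mulRight F b).lTensor A (S.sigma a) = S.sigma (a * b) := by
  simp [sigma_apply', mul_assoc]

theorem sigma_mul_left (S : SeparableFrobeniusSystem F A) (a b : A) :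
    (LinearMap.mulLeft F b).rTensor A (S.sigma a) = S.sigma (b * a) := by
  simp [sigma_apply, mul_assoc]

theorem φ_sigma_left (S : SeparableFrobeniusSystem F A) (a : A) :
    TensorProduct.lid F A (S.φ.rTensor A (S.sigma a)) = a := by
  simpa [sigma_apply] using S.sum_left a

theorem φ_sigma_right (S : SeparableFrobeniusSystem F A) (a : A) :
    TensorProduct.rid F A (S.φ.lTensor A (S.sigma a)) = a := by
  simpa [sigma_apply'] using S.sum_right a

/-- The antipode `S(α)(a) = ∑ i, φ(α(y i) a) x i` on `End A_F`. -/
noncomputable def endAntipode (S : SeparableFrobeniusSystem F A) :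
    Module.End F A →ₗ[F] Module.End F A :=
  LinearMap.mk₂ F (fun α a => ∑ i, S.φ (α (S.y i) * a) • S.x i)
    (by intros; simp [add_mul, add_smul, Finset.sum_add_distrib])
    (by intros; simp [mul_smul, Finset.smul_sum])
    (by intros; simp [mul_add, add_smul, Finset.sum_add_distrib])
    (by intros; simp [mul_smul, Finset.smul_sum])

theorem endAntipode_apply (S : SeparableFrobeniusSystem F A) (α : Module.End F A) (a : A) :
    S.endAntipode α a = ∑ i, S.φ (α (S.y i) * a) • S.x i := rfl

end SeparableFrobeniusSystem

/-- `α ⊗ β ↦ α(x) ⊗ β(y)`. -/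
noncomputable def tensorEval {F A : Type*} [Field F] [Ring A] [Algebra F A] (x y : A) :
    Module.End F A ⊗[F] Module.End F A →ₗ[F] A ⊗[F] A :=
  TensorProduct.map (LinearMap.applyₗ x) (LinearMap.applyₗ y)

/-- `α ⊗ β ⊗ γ ↦ α(x) ⊗ β(y) ⊗ γ(z)`. -/
noncomputable def tensorEval₃ {F A : Type*} [Field F] [Ring A] [Algebra F A] (x y z : A) :
    Module.End F A ⊗[F] (Module.End F A ⊗[F] Module.End F A) →ₗ[F] A ⊗[F] (A ⊗[F] A) :=
  TensorProduct.map (LinearMap.applyₗ x) (tensorEval y z)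

section

variable {F A : Type*} [Field F] [Ring A] [Algebra F A]

@[simp] theorem tensorEval_tmul (x y : A) (α β : Module.End F A) :
    tensorEval x y (α ⊗ₜ[F] β) = α x ⊗ₜ[F] β y := rfl

@[simp] theorem tensorEval₃_tmul (x y z : A) (α : Module.End F A)
    (X : Module.End F A ⊗[F] Module.End F A) :
    tensorEval₃ x y z (α ⊗ₜ[F] X) = α x ⊗ₜ[F] tensorEval y z X := rfl

theorem tensorEval_mul_tmul (V : Module.End F A ⊗[F] Module.End F A) (α β : Module.End F A)
    (x y : A) : tensorEval x y (V * (α ⊗ₜ[F] β)) = tensorEval (α x) (β y) V := by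
  induction V using TensorProduct.induction_on with
  | zero => simp
  | tmul γ δ => simp
  | add Y Z hY hZ => simp only [add_mul, map_add, hY, hZ]

theorem homTensorHomMap_apply_tmul (X : Module.End F A ⊗[F] Module.End F A) (x y : A) :
    TensorProduct.homTensorHomMap (.id F) A A A A X (x ⊗ₜ[F] y) = tensorEval x y X := by
  induction X using TensorProduct.induction_on with
  | zero => simp
  | tmul α β => simp
  | add Y Z hY hZ => simp [hY, hZ]

theorem tensorEval_ext [Module.Finite F A] {X Y : Module.End F A ⊗[F] Module.End F A}
    (h : ∀ x y, tensorEval x y X = tensorEval x y Y) : X = Y := by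
  apply (homTensorHomEquiv F A A A A).injective
  rw [homTensorHomEquiv_apply, homTensorHomEquiv_apply]
  refine TensorProduct.ext' fun x y => ?_
  rw [homTensorHomMap_apply_tmul, homTensorHomMap_apply_tmul, h]

theorem tensorEval₃_ext [Module.Finite F A]
    {X Y : Module.End F A ⊗[F] (Module.End F A ⊗[F] Module.End F A)}
    (h : ∀ x y z, tensorEval₃ x y z X = tensorEval₃ x y z Y) : X = Y := by
  apply ((homTensorHomEquiv F A A A A).lTensor (Module.End F A)).injective
  apply (homTensorHomEquiv F A (A ⊗[F] A) A (A ⊗[F] A)).injective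
  rw [homTensorHomEquiv_apply, homTensorHomEquiv_apply]
  have key : ∀ (Z : Module.End F A ⊗[F] (Module.End F A ⊗[F] Module.End F A)) (x y z : A),
      TensorProduct.homTensorHomMap (.id F) A (A ⊗[F] A) A (A ⊗[F] A)
        ((homTensorHomEquiv F A A A A).lTensor (Module.End F A) Z) (x ⊗ₜ[F] (y ⊗ₜ[F] z))
        = tensorEval₃ x y z Z := by
    intro Z x y z
    induction Z using TensorProduct.induction_on with
    | zero => simp
    | tmul α V => simp [homTensorHomEquiv_apply, homTensorHomMap_apply_tmul]
    | add Y Z hY hZ => simp only [map_add, LinearMap.add_apply, hY, hZ]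
  refine TensorProduct.ext' fun x V => ?_
  induction V using TensorProduct.induction_on with
  | zero => simp
  | tmul y z => rw [key, key, h]
  | add Y Z hY hZ => simp only [TensorProduct.tmul_add, map_add, hY, hZ]

end

namespace SeparableFrobeniusSystem

variable {F A : Type*} [Field F] [Ring A] [Algebra F A] [Module.Finite F A]

/-- The coproduct `Δ_F(α) = ∑ i, t(x i) α₍₁₎ ⊗ s(y i) α₍₂₎` on `End A_F`. -/
noncomputable def endComul (S : SeparableFrobeniusSystem F A) :
    Module.End F A →ₗ[F] Module.End F A ⊗[F] Module.End F A :=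
  S.split (endBialgebroid F A) ∘ₗ (endBialgebroid F A).comul

/-- The counit `φ(ε(α))` on `End A_F`. -/
noncomputable def endCounit (S : SeparableFrobeniusSystem F A) : Module.End F A →ₗ[F] F :=
  S.φ ∘ₗ (endBialgebroid F A).counit

theorem endCounit_apply (S : SeparableFrobeniusSystem F A) (α : Module.End F A) :
    S.endCounit α = S.φ (α 1) := rfl

theorem tensorEval_endComul (S : SeparableFrobeniusSystem F A) (α : Module.End F A) (x y : A) :
    tensorEval x y (S.endComul α) = S.sigma (α (x * y)) := by
  obtain ⟨X, hX⟩ := (balancedRel (endBialgebroid F A).source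
    (endBialgebroid F A).target).mkQ_surjective ((endBialgebroid F A).comul α)
  have h1 := (isQuasibasis_end F A).mk_eq_comul_iff.1 hX x y
  rw [endComul, LinearMap.comp_apply, ← hX]
  have h2 : ∀ Y : Module.End F A ⊗[F] Module.End F A,
      tensorEval x y (S.split (endBialgebroid F A) ((balancedRel (endBialgebroid F A).source
        (endBialgebroid F A).target).mkQ Y)) =
        S.sigma (evalTwo (AlgHom.id F (Module.End F A)) x y Y) := by
    intro Y
    induction Y using TensorProduct.induction_on with
    | zero => simp
    | tmul α β =>
      have hs : ∀ a, (endBialgebroid F A).source a = Algebra.lmul F A a := fun _ => rfl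
      have ht : ∀ a, (endBialgebroid F A).target a = Algebra.lsmul F F A a := fun _ => rfl
      have h3 := congrArg ((LinearMap.mulLeft F (α x)).rTensor A) (S.sigma_apply' (β y))
      rw [sigma_apply] at h3
      simp only [map_sum, LinearMap.rTensor_tmul, LinearMap.mulLeft_apply] at h3
      rw [sigma_apply]
      simp only [split, Submodule.mkQ_apply, Submodule.liftQ_apply, LinearMap.mulLeft_apply,
        Finset.sum_mul, map_sum, Algebra.TensorProduct.tmul_mul_tmul, tensorEval_tmul, hs, ht]
      simpa [mul_assoc] using h3.symm
    | add Y Z hY hZ => simp only [map_add, hY, hZ]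
  rw [h2, h1]
  rfl

theorem tensorEval₃_lTensor (S : SeparableFrobeniusSystem F A)
    (X : Module.End F A ⊗[F] Module.End F A) (x y z : A) :
    tensorEval₃ x y z (S.endComul.lTensor _ X) = S.sigma.lTensor A (tensorEval x (y * z) X) := by
  induction X using TensorProduct.induction_on with
  | zero => simp
  | tmul α β => simp [S.tensorEval_endComul]
  | add Y Z hY hZ => simp only [map_add, hY, hZ]

theorem tensorEval₃_rTensor (S : SeparableFrobeniusSystem F A)
    (X : Module.End F A ⊗[F] Module.End F A) (x y z : A) :
    tensorEval₃ x y z (TensorProduct.assoc F _ _ _ (S.endComul.rTensor _ X)) =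
      TensorProduct.assoc F A A A (S.sigma.rTensor A (tensorEval (x * y) z X)) := by
  induction X using TensorProduct.induction_on with
  | zero => simp
  | tmul α β =>
    have : ∀ V : Module.End F A ⊗[F] Module.End F A,
        tensorEval₃ x y z (TensorProduct.assoc F _ _ _ (V ⊗ₜ[F] β)) =
          TensorProduct.assoc F A A A (tensorEval x y V ⊗ₜ[F] β z) := by
      intro V
      induction V using TensorProduct.induction_on with
      | zero => simp
      | tmul α β => simp
      | add Y Z hY hZ => simp only [TensorProduct.add_tmul, map_add, hY, hZ]
    simp [this, S.tensorEval_endComul]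
  | add Y Z hY hZ => simp only [map_add, hY, hZ]

theorem mul_endAntipode (S : SeparableFrobeniusSystem F A) (α : Module.End F A) (a : A) :
    LinearMap.mul' F _ (S.endAntipode.lTensor _ (S.endComul α)) a = α 1 * a := by
  have h1 : ∀ X : Module.End F A ⊗[F] Module.End F A,
      LinearMap.mul' F _ (S.endAntipode.lTensor _ X) a =
        TensorProduct.rid F A ((S.φ ∘ₗ LinearMap.mulRight F a).lTensor A
          (∑ i, tensorEval (S.x i) (S.y i) X)) := by
    intro X
    induction X using TensorProduct.induction_on with
    | zero => simp
    | tmul β γ => simp [endAntipode_apply]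
    | add Y Z hY hZ =>
      simp only [map_add, LinearMap.add_apply, hY, hZ, Finset.sum_add_distrib]
  rw [h1]
  simp only [S.tensorEval_endComul, ← map_sum, S.sum_mul]
  rw [LinearMap.lTensor_comp, LinearMap.comp_apply, S.sigma_mul_right, S.φ_sigma_right]

theorem triple_mul_add {F H : Type*} [Field F] [Ring H] [Algebra F H]
    (X Y Z : H ⊗[F] (H ⊗[F] H)) : X * (Y + Z) = X * Y + X * Z := mul_add X Y Z

theorem triple_add_mul {F H : Type*} [Field F] [Ring H] [Algebra F H]
    (X Y Z : H ⊗[F] (H ⊗[F] H)) : (X + Y) * Z = X * Z + Y * Z := add_mul X Y Z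

theorem triple_mul_zero {F H : Type*} [Field F] [Ring H] [Algebra F H]
    (X : H ⊗[F] (H ⊗[F] H)) : X * 0 = 0 := mul_zero X

theorem triple_zero_mul {F H : Type*} [Field F] [Ring H] [Algebra F H]
    (X : H ⊗[F] (H ⊗[F] H)) : 0 * X = 0 := zero_mul X

/-- The weak Hopf algebra `End A_F` associated to the left bialgebroid `End A_F` over `A` and a
separable Frobenius system of `A`. -/
noncomputable def endWeakHopf (S : SeparableFrobeniusSystem F A) :
    WeakHopfAlgebra F (Module.End F A) where
  comul := S.endComul
  counit := S.endCounit
  antipode := S.endAntipode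
  coassoc := by
    refine LinearMap.ext fun α => tensorEval₃_ext fun x y z => ?_
    simp only [LinearMap.comp_apply, LinearEquiv.coe_coe]
    rw [S.tensorEval₃_lTensor, S.tensorEval₃_rTensor, S.tensorEval_endComul,
      S.tensorEval_endComul, S.sigma_coassoc, mul_assoc]
  rTensor_counit_comp_comul := by
    refine LinearMap.ext fun α => (TensorProduct.lid F _).injective (LinearMap.ext fun y => ?_)
    have : ∀ X : Module.End F A ⊗[F] Module.End F A,
        TensorProduct.lid F _ (S.endCounit.rTensor _ X) y =
          TensorProduct.lid F A (S.φ.rTensor A (tensorEval 1 y X)) := by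
      intro X
      induction X using TensorProduct.induction_on with
      | zero => simp
      | tmul β γ => simp [endCounit_apply]
      | add Y Z hY hZ => simp only [map_add, LinearMap.add_apply, hY, hZ]
    rw [LinearMap.comp_apply, this, S.tensorEval_endComul, S.φ_sigma_left]
    simp
  lTensor_counit_comp_comul := by
    refine LinearMap.ext fun α => (TensorProduct.rid F _).injective (LinearMap.ext fun y => ?_)
    have : ∀ X : Module.End F A ⊗[F] Module.End F A,
        TensorProduct.rid F _ (S.endCounit.lTensor _ X) y =
          TensorProduct.rid F A (S.φ.lTensor A (tensorEval y 1 X)) := by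
      intro X
      induction X using TensorProduct.induction_on with
      | zero => simp
      | tmul β γ => simp [endCounit_apply]
      | add Y Z hY hZ => simp only [map_add, LinearMap.add_apply, hY, hZ]
    rw [LinearMap.comp_apply, this, S.tensorEval_endComul, S.φ_sigma_right]
    simp
  comul_mul α β := by
    refine tensorEval_ext fun x y => ?_
    have : ∀ Z : Module.End F A ⊗[F] Module.End F A, tensorEval x y (S.endComul α * Z) =
        S.sigma (α (LinearMap.mul' F A (tensorEval x y Z))) := by
      intro Z
      induction Z using TensorProduct.induction_on with
      | zero => simp
      | tmul γ δ => simp [tensorEval_mul_tmul, S.tensorEval_endComul]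
      | add Y Z hY hZ => simp only [mul_add, map_add, hY, hZ]
    rw [this, S.tensorEval_endComul, S.tensorEval_endComul, S.mul_sigma, Module.End.mul_apply]
  comul_one_left := by
    refine tensorEval₃_ext fun x y z => ?_
    have : ∀ X : Module.End F A ⊗[F] Module.End F A,
        tensorEval₃ x y z (((1 : Module.End F A) ⊗ₜ[F] S.endComul 1) *
          TensorProduct.assoc F _ _ _ (X ⊗ₜ[F] (1 : Module.End F A))) =
        S.sigma.lTensor A ((LinearMap.mulRight F z).lTensor A (tensorEval x y X)) := by
      intro X
      induction X using TensorProduct.induction_on with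
      | zero => simp [triple_mul_zero]
      | tmul γ δ => simp [tensorEval_mul_tmul, S.tensorEval_endComul]
      | add Y Z hY hZ => simp only [TensorProduct.add_tmul, triple_mul_add, map_add, hY, hZ]
    rw [this, S.tensorEval₃_lTensor, S.tensorEval_endComul, S.tensorEval_endComul,
      S.sigma_mul_right]
    simp [mul_assoc]
  comul_one_right := by
    refine tensorEval₃_ext fun x y z => ?_
    have : ∀ X : Module.End F A ⊗[F] Module.End F A,
        tensorEval₃ x y z (TensorProduct.assoc F _ _ _
          (S.endComul 1 ⊗ₜ[F] (1 : Module.End F A)) * ((1 : Module.End F A) ⊗ₜ[F] X)) =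
        TensorProduct.assoc F A A A (S.sigma.rTensor A
          ((LinearMap.mulLeft F x).rTensor A (tensorEval y z X))) := by
      intro X
      induction X using TensorProduct.induction_on with
      | zero => simp [triple_mul_zero]
      | tmul γ δ =>
        have h : ∀ V : Module.End F A ⊗[F] Module.End F A,
            tensorEval₃ x y z (TensorProduct.assoc F _ _ _ (V ⊗ₜ[F] (1 : Module.End F A)) *
              ((1 : Module.End F A) ⊗ₜ[F] (γ ⊗ₜ[F] δ))) =
            TensorProduct.assoc F A A A (tensorEval x (γ y) V ⊗ₜ[F] δ z) := by
          intro V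
          induction V using TensorProduct.induction_on with
          | zero => simp [triple_zero_mul]
          | tmul γ δ => simp
          | add Y Z hY hZ => simp only [TensorProduct.add_tmul, triple_add_mul, map_add, hY, hZ]
        rw [h, S.tensorEval_endComul]
        simp
      | add Y Z hY hZ => simp only [TensorProduct.tmul_add, triple_mul_add, map_add, hY, hZ]
    rw [this, S.tensorEval₃_lTensor, S.tensorEval_endComul, S.tensorEval_endComul,
      S.sigma_mul_left, S.sigma_coassoc]
    simp
  counit_mul_left β α γ := by
    have : ∀ X : Module.End F A ⊗[F] Module.End F A,
        LinearMap.mul' F F (TensorProduct.map (S.endCounit ∘ₗ LinearMap.mulLeft F β)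
          (S.endCounit ∘ₗ LinearMap.mulRight F γ) X) =
        S.φ (β (TensorProduct.rid F A (S.φ.lTensor A (tensorEval 1 (γ 1) X)))) := by
      intro X
      induction X using TensorProduct.induction_on with
      | zero => simp
      | tmul δ η => simp [endCounit_apply, mul_comm]
      | add Y Z hY hZ => simp only [map_add, hY, hZ]
    rw [this, S.tensorEval_endComul, S.φ_sigma_right]
    simp [endCounit_apply]
  counit_mul_right β α γ := by
    have : ∀ X : Module.End F A ⊗[F] Module.End F A,
        LinearMap.mul' F F (TensorProduct.map (S.endCounit ∘ₗ LinearMap.mulRight F γ)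
          (S.endCounit ∘ₗ LinearMap.mulLeft F β) X) =
        S.φ (β (TensorProduct.lid F A (S.φ.rTensor A (tensorEval (γ 1) 1 X)))) := by
      intro X
      induction X using TensorProduct.induction_on with
      | zero => simp
      | tmul δ η => simp [endCounit_apply]
      | add Y Z hY hZ => simp only [map_add, hY, hZ]
    rw [this, S.tensorEval_endComul, S.φ_sigma_left]
    simp [endCounit_apply]
  mul_antipode α := by
    refine LinearMap.ext fun a => ?_
    rw [S.mul_endAntipode]
    have : ∀ X : Module.End F A ⊗[F] Module.End F A,
        TensorProduct.lid F _ ((S.endCounit ∘ₗ LinearMap.mulRight F α).rTensor _ X) a =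
          TensorProduct.lid F A (S.φ.rTensor A (tensorEval (α 1) a X)) := by
      intro X
      induction X using TensorProduct.induction_on with
      | zero => simp
      | tmul β γ => simp [endCounit_apply]
      | add Y Z hY hZ => simp only [map_add, LinearMap.add_apply, hY, hZ]
    rw [this, S.tensorEval_endComul, S.φ_sigma_left, Module.End.one_apply]
  antipode_mul α := by
    refine LinearMap.ext fun a => ?_
    have h1 : ∀ X : Module.End F A ⊗[F] Module.End F A,
        LinearMap.mul' F _ (S.endAntipode.rTensor _ X) a =
          ∑ i, S.φ (LinearMap.mul' F A (tensorEval (S.y i) a X)) • S.x i := by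
      intro X
      induction X using TensorProduct.induction_on with
      | zero => simp
      | tmul β γ => simp [endAntipode_apply]
      | add Y Z hY hZ =>
        simp only [map_add, LinearMap.add_apply, hY, hZ, add_smul, Finset.sum_add_distrib]
    have h2 : ∀ X : Module.End F A ⊗[F] Module.End F A,
        TensorProduct.rid F _ ((S.endCounit ∘ₗ LinearMap.mulLeft F α).lTensor _ X) a =
          TensorProduct.rid F A ((S.φ ∘ₗ α).lTensor A (tensorEval a 1 X)) := by
      intro X
      induction X using TensorProduct.induction_on with
      | zero => simp
      | tmul β γ => simp [endCounit_apply]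
      | add Y Z hY hZ => simp only [map_add, LinearMap.add_apply, hY, hZ]
    rw [h1, h2]
    simp only [S.tensorEval_endComul, S.mul_sigma]
    rw [sigma_apply']
    simp
  antipode_mul_antipode α := by
    refine LinearMap.ext fun a => ?_
    have h1 : ∀ X : Module.End F A ⊗[F] Module.End F A,
        LinearMap.mul' F _ (TensorProduct.map S.endAntipode
          (LinearMap.mul' F _ ∘ₗ S.endAntipode.lTensor _ ∘ₗ S.endComul) X) a =
          ∑ i, S.φ (LinearMap.mul' F A (tensorEval (S.y i) 1 X) * a) • S.x i := by
      intro X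
      induction X using TensorProduct.induction_on with
      | zero => simp
      | tmul β γ => simp [endAntipode_apply, mul_endAntipode, mul_assoc]
      | add Y Z hY hZ =>
        simp only [map_add, LinearMap.add_apply, hY, hZ, add_mul, add_smul,
          Finset.sum_add_distrib]
    rw [h1]
    simp only [S.tensorEval_endComul, S.mul_sigma, mul_one]
    rfl

end SeparableFrobeniusSystem

end WeakHopf

/-! ## Intermediate fields, endomorphisms and invariants -/

section Galois

variable (F A : Type*) [Field F] [Ring A] [Algebra F A]

/-- The fields `E` with `F ⊆ E ⊆ Z(A)`, ordered by inclusion. -/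
abbrev CentralIntermediateField : Type _ :=
  {E : Subalgebra F A // E ≤ Subalgebra.center F A ∧ IsField E}

variable {F A}

/-- `End A_E`: the `F`-linear endomorphisms `α` of `A` with `α(x y) = α(x) y` for `y ∈ E`. -/
def galEnd (E : Subalgebra F A) : Subalgebra F (Module.End F A) where
  carrier := {α | ∀ x, ∀ y ∈ E, α (x * y) = α x * y}
  mul_mem' {α β} hα hβ x y hy := by
    simp only [Module.End.mul_apply, hβ x y hy, hα _ y hy]
  add_mem' {α β} hα hβ x y hy := by
    simp only [LinearMap.add_apply, hα x y hy, hβ x y hy, add_mul]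
  algebraMap_mem' r x y _ := by simp

/-- The invariants `A^W = {x ∈ A | α(x) = α(1) x for all α ∈ W}`. -/
def fixSet (W : Subalgebra F (Module.End F A)) : Set A :=
  {x | ∀ α ∈ W, α x = α 1 * x}

end Galois

/-! ## Subalgebras of `End A_F` that contain the multiplications -/

/-! Both correspondences are instances of one double centralizer argument. Let `W` be a subalgebra
of `End A_F` that contains all left and right multiplications. The `W`-submodules of `A` are
two-sided ideals, so `A` is a simple `W`-module. An endomorphism commuting with `W` is
multiplication by its value at 1, which is central, so `End_W A` is a field `E` between `F` and
`Z(A)`, equal to `A^W`. Jacobson density and finite dimension give `W = End A_E`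
(`galEnd_linearityCenter`). Conversely, `E`-linear functionals separate the points outside `E` from
1, so `E` is recovered from `End A_E` (`linearityCenter_galEnd`).

It remains to show that each class of subalgebras contains every `End A_E` and that its members
contain the multiplications. For sub-bialgebroids, the multiplications are source and target, and an
`E`-basis of `A` gives `End A_E` its own coproduct. For weak Hopf subalgebras, the multiplications
are slices of `Δ(1) = ∑ ρ_{x i} ⊗ λ_{y i}`, while the Casimir identity makes `End A_E` stable under
the antipode.

A separable Frobenius system is obtained from a trace form on a matrix algebra. Its dual bases give
the map `c ↦ ∑ x i c y i` into the centre. Separability makes this map nonzero, hence nonzero at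
some unit, and twisting by that unit normalises `∑ x i y i` to 1. -/

section Multiplications

variable {F A : Type*} [Field F] [Ring A] [Algebra F A]

/-- The subalgebra `W` of `End A_F` contains all left and all right multiplications. -/
structure ContainsMultiplications (W : Subalgebra F (Module.End F A)) : Prop where
  left : ∀ a : A, LinearMap.mulLeft F a ∈ W
  right : ∀ a : A, LinearMap.mulRight F a ∈ W

theorem containsMultiplications_galEnd {E : Subalgebra F A} (hE : E ≤ Subalgebra.center F A) :
    ContainsMultiplications (galEnd E) where
  left a x y _ := by simp [mul_assoc]
  right a x y hy := by
    have := Subalgebra.mem_center_iff.1 (hE hy) a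
    simp [mul_assoc, this]

theorem galEnd_anti {E E' : Subalgebra F A} (h : E ≤ E') : galEnd E' ≤ galEnd E :=
  fun _ hα x y hy => hα x y (h hy)

/-- The central elements `z` of `A` such that `W` consists of `z`-linear maps. -/
def linearityCenter (W : Subalgebra F (Module.End F A)) : Subalgebra F A where
  carrier := {z | z ∈ Subalgebra.center F A ∧ ∀ α ∈ W, ∀ x, α (x * z) = α x * z}
  mul_mem' {y z} hy hz := ⟨mul_mem hy.1 hz.1, fun α hα x => by
    rw [← mul_assoc, hz.2 α hα, hy.2 α hα, mul_assoc]⟩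
  add_mem' {y z} hy hz := ⟨add_mem hy.1 hz.1, fun α hα x => by
    rw [mul_add, map_add, hz.2 α hα, hy.2 α hα, mul_add]⟩
  algebraMap_mem' r := ⟨algebraMap_mem _ r, fun α _ x => by
    rw [← Algebra.commutes, ← Algebra.smul_def, map_smul, Algebra.smul_def, Algebra.commutes]⟩

theorem linearityCenter_le_center (W : Subalgebra F (Module.End F A)) :
    linearityCenter W ≤ Subalgebra.center F A := fun _ hz => hz.1

theorem le_galEnd_linearityCenter (W : Subalgebra F (Module.End F A)) :
    W ≤ galEnd (linearityCenter W) := fun α hα x _ hy => hy.2 α hα x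

namespace ContainsMultiplications

variable {W : Subalgebra F (Module.End F A)}

/-- Testing invariance of `z` on right multiplications gives centrality; testing it on `α` composed
with left multiplication by `x` gives `α(xz) = α(x)z`. In particular `A^W` is a subalgebra. -/
theorem coe_linearityCenter (hW : ContainsMultiplications W) :
    (linearityCenter W : Set A) = fixSet W := by
  ext z
  constructor
  · intro hz α hα
    simpa using hz.2 α hα 1
  · intro hz
    refine ⟨Subalgebra.mem_center_iff.2 fun a => ?_, fun α hα x => ?_⟩
    · simpa using (hz _ (hW.right a)).symm
    · simpa using hz _ (mul_mem hα (hW.left x))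

/-- The centralizer of `W` consists of the multiplications by the elements of its
linearity centre. -/
theorem map_lmul_linearityCenter (hW : ContainsMultiplications W) :
    (linearityCenter W).map (Algebra.lmul F A) =
      Subalgebra.centralizer F (W : Set (Module.End F A)) := by
  ext δ
  rw [Subalgebra.mem_map, Subalgebra.mem_centralizer_iff]
  constructor
  · rintro ⟨z, hz, rfl⟩ α hα
    ext x
    have h := Subalgebra.mem_center_iff.1 hz.1
    have := hz.2 α hα x
    simpa [h] using this
  · intro h
    have happ : ∀ α ∈ W, ∀ x, α (δ x) = δ (α x) := fun α hα x => LinearMap.congr_fun (h α hα) x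
    have hl : ∀ x, x * δ 1 = δ x := fun x => by simpa using happ _ (hW.left x) 1
    have hr : ∀ x, δ 1 * x = δ x := fun x => by simpa using happ _ (hW.right x) 1
    refine ⟨δ 1, ⟨Subalgebra.mem_center_iff.2 fun a => by rw [hl, hr], fun α hα x => ?_⟩,
      LinearMap.ext hr⟩
    rw [hl, hl, happ α hα]

/-- A `W`-submodule of `A` is stable under left and right multiplications, hence is a two-sided
ideal. -/
theorem isSimpleModule [IsSimpleRing A] (hW : ContainsMultiplications W) :
    IsSimpleModule W A := by
  have hl : ∀ (N : Submodule W A) (a : A) {x : A}, x ∈ N → a * x ∈ N := fun N a x hx =>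
    N.smul_mem ⟨_, hW.left a⟩ hx
  have hr : ∀ (N : Submodule W A) (a : A) {x : A}, x ∈ N → x * a ∈ N := fun N a x hx =>
    N.smul_mem ⟨_, hW.right a⟩ hx
  have hn : ∀ (N : Submodule W A) {x : A}, x ∈ N → -x ∈ N := fun N x hx => by
    simpa using hl N (-1) hx
  have : IsSimpleOrder (Submodule W A) :=
    { exists_pair_ne := exists_pair_ne _
      eq_bot_or_eq_top := fun N => by
        have hmem : ∀ x, x ∈ TwoSidedIdeal.mk' (N : Set A) N.zero_mem N.add_mem (hn N)
          (fun h => hl N _ h) (fun h => hr N _ h) ↔ x ∈ N := fun x =>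
            TwoSidedIdeal.mem_mk' _ _ _ _ _ _ _
        rcases eq_bot_or_eq_top (TwoSidedIdeal.mk' (N : Set A) N.zero_mem N.add_mem (hn N)
          (fun h => hl N _ h) (fun h => hr N _ h)) with h | h
        · left
          refine (Submodule.eq_bot_iff _).2 fun x hx => ?_
          have := (hmem x).2 hx
          rwa [h, TwoSidedIdeal.mem_bot] at this
        · right
          refine Submodule.eq_top_iff'.2 fun x => (hmem x).1 ?_
          rw [h]
          trivial }
  exact ⟨⟩

/-- By the density theorem, `W` is the algebra of all endomorphisms that are linear over its
linearity centre. -/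
theorem galEnd_linearityCenter [IsSimpleRing A] [FiniteDimensional F A]
    (hW : ContainsMultiplications W) : galEnd (linearityCenter W) = W := by
  refine le_antisymm (fun α hα => ?_) (le_galEnd_linearityCenter W)
  have := hW.isSimpleModule
  -- A `W`-linear `δ` commutes with both kinds of multiplication, so it is multiplication by the
  -- central element `δ 1`; commuting with the rest of `W` puts `δ 1` in the linearity centre.
  have hδ : ∀ (δ : Module.End W A) (x : A), δ x = x * δ 1 ∧ δ 1 ∈ linearityCenter W := by
    intro δ
    have hl : ∀ x, δ x = x * δ 1 := fun x => by
      simpa [Subalgebra.smul_def] using δ.map_smul ⟨_, hW.left x⟩ 1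
    have hr : ∀ x, δ x = δ 1 * x := fun x => by
      simpa [Subalgebra.smul_def] using δ.map_smul ⟨_, hW.right x⟩ 1
    refine fun x => ⟨hl x, Subalgebra.mem_center_iff.2 fun a => by rw [← hl, ← hr],
      fun β hβ y => ?_⟩
    rw [← hl, ← hl]
    exact (δ.map_smul ⟨β, hβ⟩ y).symm
  let f : Module.End (Module.End W A) A :=
    { toFun := α
      map_add' := map_add α
      map_smul' := fun δ x => by
        change α (δ x) = δ (α x)
        rw [(hδ δ x).1, (hδ δ (α x)).1, hα x _ (hδ δ x).2] }
  classical
  let b := Module.finBasis F A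
  -- Density only interpolates on finite sets; an `F`-basis is a finite set on which agreement means
  -- equality.
  obtain ⟨w, hw⟩ := jacobson_density (R := W) f (Finset.univ.image b)
  have : α = (w : Module.End F A) := b.ext fun k =>
    hw (b k) (Finset.mem_image_of_mem _ (Finset.mem_univ k))
  rw [this]
  exact w.2

end ContainsMultiplications

/-- The centre of a simple ring is a field, and linearity passes from `z` to its inverse `y`: `α(x)
= α(xy)z`, so `α(xy) = α(x)y`. -/
theorem isField_linearityCenter [IsSimpleRing A] (W : Subalgebra F (Module.End F A)) :
    IsField (linearityCenter W) where
  exists_pair_ne := ⟨0, 1, zero_ne_one⟩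
  mul_comm y z := Subtype.ext (Subalgebra.mem_center_iff.1 z.2.1 y)
  mul_inv_cancel := by
    rintro ⟨z, hz⟩ hne
    obtain ⟨⟨y, hy⟩, hzy⟩ := (IsSimpleRing.isField_center A).mul_inv_cancel
      (a := ⟨z, Subring.mem_center_iff.2 (Subalgebra.mem_center_iff.1 hz.1)⟩)
      (fun h => hne (Subtype.ext (show z = 0 from congrArg Subtype.val h)))
    have hzy : z * y = 1 := congrArg Subtype.val hzy
    have hy := Subring.mem_center_iff.1 hy
    refine ⟨⟨y, Subalgebra.mem_center_iff.2 hy, fun α hα x => ?_⟩, Subtype.ext hzy⟩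
    have := hz.2 α hα (x * y)
    rw [mul_assoc, ← hy, hzy, mul_one] at this
    rw [this, mul_assoc, hzy, mul_one]

end Multiplications

/-! ## Endomorphisms over an intermediate field -/

section IntermediateField

variable {F A : Type*} [Field F] [Ring A] [Algebra F A] {E : Subalgebra F A}

/-- An `E`-linear functional on `A`, as an element of `End A_E`. -/
def functionalToGalEnd (hE : E ≤ Subalgebra.center F A) (f : A →ₗ[E] E) : galEnd E :=
  ⟨E.val.toLinearMap ∘ₗ f.restrictScalars F, fun x y hy => by
    have h : x * y = (⟨y, hy⟩ : E) • x := Subalgebra.mem_center_iff.1 (hE hy) x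
    change ((f (x * y) : E) : A) = f x * y
    rw [h, map_smul]
    exact (Subalgebra.mem_center_iff.1 (hE hy) _).symm⟩

theorem functionalToGalEnd_apply (hE : E ≤ Subalgebra.center F A) (f : A →ₗ[E] E) (x : A) :
    (functionalToGalEnd hE f : Module.End F A) x = f x := rfl

/-- If `z ∉ E`, some `E`-linear functional `f` kills 1 but not `z`. As an element of `End A_E` it
would satisfy `f(z) = f(1)z = 0`. -/
theorem linearityCenter_galEnd (hE : E ≤ Subalgebra.center F A) (hF : IsField E) :
    linearityCenter (galEnd E) = E := by
  refine le_antisymm (fun z hz => ?_) fun z hz => ⟨hE hz, fun α hα x => hα x z hz⟩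
  by_contra hzE
  let _ := hF.toField
  have hz1 : z ∉ Submodule.span E {(1 : A)} := by
    rw [Submodule.mem_span_singleton]
    rintro ⟨c, rfl⟩
    exact hzE (by simp [Subalgebra.smul_def])
  obtain ⟨f, hfz, hf⟩ := Submodule.exists_le_ker_of_notMem hz1
  have h1 : f 1 = 0 := hf (Submodule.mem_span_singleton_self 1)
  have := hz.2 _ (functionalToGalEnd hE f).2 1
  rw [one_mul, functionalToGalEnd_apply, functionalToGalEnd_apply, h1] at this
  exact hfz (Subtype.ext (by simpa using this))

/-- The source map of `End A_E`. -/
def galEndSource (hE : E ≤ Subalgebra.center F A) : A →ₐ[F] galEnd E :=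
  (Algebra.lmul F A).codRestrict _ (containsMultiplications_galEnd hE).left

/-- The target map of `End A_E`. -/
def galEndTarget (hE : E ≤ Subalgebra.center F A) : Aᵐᵒᵖ →ₐ[F] galEnd E :=
  (Algebra.lsmul F F A).codRestrict _ fun a =>
    (containsMultiplications_galEnd hE).right a.unop

/-- The coordinate functionals of an `E`-basis of `A` form a right depth two quasibasis of
`End A_E`. -/
theorem exists_isQuasibasis_galEnd [FiniteDimensional F A] (hE : E ≤ Subalgebra.center F A)
    (hF : IsField E) : ∃ (n : ℕ) (γ : Fin n → galEnd E) (u : Fin n → A),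
      IsQuasibasis (galEnd E).val (galEndSource hE) (galEndTarget hE) γ u := by
  let _ := hF.toField
  have : IsScalarTower F E A := ⟨fun r c x => by simp [Subalgebra.smul_def]⟩
  have : Module.Finite E A := Module.Finite.of_restrictScalars_finite F E A
  let b := Module.finBasis E A
  refine ⟨_, fun k => functionalToGalEnd hE (b.coord k), b, ?_⟩
  refine ⟨Subtype.val_injective, fun _ _ => rfl, fun _ _ => rfl, fun h => Subtype.ext ?_⟩
  ext x
  have hx : (h : Module.End F A) x = ∑ k, (h : Module.End F A) (b.repr x k • b k) := by
    rw [← map_sum, b.sum_repr]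
  -- Linearity takes the coordinate out of `h` on the right; centrality moves it to the left, since
  -- the target map multiplies by `h (b k)` on the right.
  have hs : ∀ k, (h : Module.End F A) (b.repr x k • b k)
      = (b.repr x k : A) * (h : Module.End F A) (b k) := fun k => by
    have hc := Subalgebra.mem_center_iff.1 (hE (b.repr x k).2)
    rw [Subalgebra.smul_def, smul_eq_mul, ← hc, h.2 _ _ (b.repr x k).2, hc]
  rw [hx, AddSubmonoidClass.coe_finsetSum, LinearMap.sum_apply]
  exact Finset.sum_congr rfl fun k _ => (hs k).symm

/-! ### Sub-bialgebroids of `End A_F` -/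

theorem evalTwo_map_val (W : Subalgebra F (Module.End F A)) (x y : A) (X : W ⊗[F] W) :
    evalTwo (AlgHom.id F (Module.End F A)) x y
      (TensorProduct.map W.val.toLinearMap W.val.toLinearMap X) = evalTwo (H := W) W.val x y X := by
  induction X using TensorProduct.induction_on with
  | zero => simp
  | tmul α β => simp
  | add Y Z hY hZ => simp only [map_add, hY, hZ]

theorem mk_eq_comul_endBialgebroid_iff [FiniteDimensional F A]
    {X : Module.End F A ⊗[F] Module.End F A} {α : Module.End F A} :
    (balancedRel (endBialgebroid F A).source (endBialgebroid F A).target).mkQ X =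
      (endBialgebroid F A).comul α ↔
    ∀ x y, evalTwo (AlgHom.id F (Module.End F A)) x y X = α (x * y) :=
  (isQuasibasis_end F A).mk_eq_comul_iff

/-- The quasibasis gives `End A_E` a coproduct determined by `α₍₁₎(x) α₍₂₎(y) = α(xy)`. The ambient
coproduct is determined by the same rule, and evaluation at pairs does not depend on where the
tensor lives. -/
theorem isSubBialgebroid_galEnd [FiniteDimensional F A] (hE : E ≤ Subalgebra.center F A)
    (hF : IsField E) : (endBialgebroid F A).IsSubBialgebroid (galEnd E) := by
  obtain ⟨n, γ, u, Q⟩ := exists_isQuasibasis_galEnd hE hF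
  refine ⟨Q.bialgebroid, fun _ => rfl, fun _ => rfl, fun w X hX => ?_, fun _ => rfl⟩
  rw [mk_eq_comul_endBialgebroid_iff]
  intro x y
  rw [evalTwo_map_val]
  exact Q.mk_eq_comul_iff.1 hX x y

theorem LeftBialgebroid.IsSubBialgebroid.containsMultiplications [FiniteDimensional F A]
    {W : Subalgebra F (Module.End F A)} (hW : (endBialgebroid F A).IsSubBialgebroid W) :
    ContainsMultiplications W := by
  obtain ⟨B, hs, ht, -, -⟩ := hW
  refine ⟨fun a => ?_, fun a => ?_⟩
  · have : LinearMap.mulLeft F a = (B.source a : Module.End F A) := (hs a).symm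
    exact this ▸ (B.source a).2
  · have : LinearMap.mulRight F a = (B.target (MulOpposite.op a) : Module.End F A) :=
      (ht (MulOpposite.op a)).symm
    exact this ▸ (B.target _).2

/-- The correspondence between intermediate fields and a class of subalgebras of `End A_F` that
contain the multiplications. -/
theorem exists_orderIso_centralIntermediateField [FiniteDimensional F A] [IsSimpleRing A]
    (P : Subalgebra F (Module.End F A) → Prop)
    (hgal : ∀ E : Subalgebra F A, E ≤ Subalgebra.center F A → IsField E → P (galEnd E))
    (hmul : ∀ W, P W → ContainsMultiplications W) :
    ∃ Γ : CentralIntermediateField F A ≃o {W : Subalgebra F (Module.End F A) // P W}ᵒᵈ,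
      (∀ E, (OrderDual.ofDual (Γ E)).1 = galEnd E.1) ∧
      (∀ W, ((Γ.symm (OrderDual.toDual W)).1 : Set A) = fixSet W.1) ∧
      (∀ W, ((Γ.symm (OrderDual.toDual W)).1).map (Algebra.lmul F A) =
        Subalgebra.centralizer F (W.1 : Set (Module.End F A))) := by
  refine ⟨{ toFun := fun E => OrderDual.toDual ⟨galEnd E.1, hgal E.1 E.2.1 E.2.2⟩
            invFun := fun W => ⟨linearityCenter (OrderDual.ofDual W).1,
              linearityCenter_le_center _, isField_linearityCenter _⟩
            left_inv := fun E => Subtype.ext (linearityCenter_galEnd E.2.1 E.2.2)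
            right_inv := fun W => congrArg OrderDual.toDual
              (Subtype.ext (hmul _ (OrderDual.ofDual W).2).galEnd_linearityCenter)
            map_rel_iff' := ?_ }, fun _ => rfl, fun W => (hmul _ W.2).coe_linearityCenter,
          fun W => (hmul _ W.2).map_lmul_linearityCenter⟩
  intro E E'
  refine ⟨fun h => ?_, fun h => galEnd_anti h⟩
  have h : galEnd E'.1 ≤ galEnd E.1 := h
  change E.1 ≤ E'.1
  -- Each field is recovered as a linearity centre, and linearity centres reverse inclusions.
  rw [← linearityCenter_galEnd E.2.1 E.2.2, ← linearityCenter_galEnd E'.2.1 E'.2.2]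
  exact fun z hz => ⟨hz.1, fun α hα => hz.2 α (h hα)⟩

end IntermediateField

/-! ## Weak Hopf subalgebras -/

namespace SeparableFrobeniusSystem

variable {F A : Type*} [Field F] [Ring A] [Algebra F A] [FiniteDimensional F A]

/-- The splitting of `H ⊗ H → H ⊗_A H` is left multiplication by a fixed tensor, so any
representative of `Δ(α)` may be used, in particular one with both legs in a given subalgebra. -/
theorem endComul_eq (S : SeparableFrobeniusSystem F A) {α : Module.End F A}
    {X : Module.End F A ⊗[F] Module.End F A} (hX : ∀ x y,
      evalTwo (AlgHom.id F (Module.End F A)) x y X = α (x * y)) :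
    S.endComul α =
      (∑ i, LinearMap.mulRight F (S.x i) ⊗ₜ[F] LinearMap.mulLeft F (S.y i)) * X := by
  rw [endComul, LinearMap.comp_apply, ← mk_eq_comul_endBialgebroid_iff.2 hX]
  rfl

theorem endComul_one (S : SeparableFrobeniusSystem F A) :
    S.endComul 1 = ∑ i, LinearMap.mulRight F (S.x i) ⊗ₜ[F] LinearMap.mulLeft F (S.y i) := by
  rw [S.endComul_eq (X := 1 ⊗ₜ[F] 1) fun x y => by simp, ← Algebra.TensorProduct.one_def, mul_one]

theorem isWeakHopfSubalgebra_galEnd (S : SeparableFrobeniusSystem F A) {E : Subalgebra F A}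
    (hE : E ≤ Subalgebra.center F A) (hF : IsField E) :
    S.endWeakHopf.IsWeakHopfSubalgebra (galEnd E) := by
  intro α hα
  constructor
  · obtain ⟨n, γ, u, Q⟩ := exists_isQuasibasis_galEnd hE hF
    obtain ⟨X, hX⟩ := Submodule.mkQ_surjective _ (Q.comul ⟨α, hα⟩)
    rw [Q.mk_eq_comul_iff] at hX
    -- `V` is `Δ(1)` written with legs in `End A_E`, and `X` represents the coproduct of `α` there.
    -- Since `m` is multiplicative, `V * X` is a preimage of `Δ(α)`.
    let V : galEnd E ⊗[F] galEnd E :=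
      ∑ i, galEndTarget hE (MulOpposite.op (S.x i)) ⊗ₜ[F] galEndSource hE (S.y i)
    let m := Algebra.TensorProduct.map (galEnd E).val (galEnd E).val
    have hV : m V = ∑ i, LinearMap.mulRight F (S.x i) ⊗ₜ[F] LinearMap.mulLeft F (S.y i) := by
      rw [map_sum]
      rfl
    refine ⟨V * X, ?_⟩
    change m (V * X) = S.endComul α
    rw [S.endComul_eq (α := α) (X := m X) fun x y => (evalTwo_map_val _ x y X).trans (hX x y),
      map_mul, hV]
  · intro a z hz
    have hc := Subalgebra.mem_center_iff.1 (hE hz)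
    change S.endAntipode α (a * z) = S.endAntipode α a * z
    rw [endAntipode_apply, endAntipode_apply]
    -- Applied to the Casimir identity, `f` gives `∑ φ(α(y i) a) z x i = ∑ φ(α(y i z) a) x i`, which
    -- is linearity of the antipode of `α` in the central element `z`.
    let f : A ⊗[F] A →ₗ[F] A := TensorProduct.lift
      (LinearMap.toSpanSingleton F (Module.End F A) 1 ∘ₗ S.φ ∘ₗ LinearMap.mulRight F a ∘ₗ α).flip
    have hf : ∀ x y, f (x ⊗ₜ[F] y) = S.φ (α y * a) • x := fun x y => by simp [f]
    have h := congrArg f (S.casimir z)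
    simp only [map_sum, hf] at h
    rw [Finset.sum_mul]
    refine Eq.trans (Finset.sum_congr rfl fun i _ => ?_)
      (h.symm.trans (Finset.sum_congr rfl fun i _ => ?_))
    · rw [hα _ z hz, mul_assoc, ← hc a]
    · rw [smul_mul_assoc, hc]

/-- Slices of `Δ(1) = ∑ ρ_{x i} ⊗ λ_{y i} ∈ W ⊗ W` lie in `W`. Slicing the first leg by `β ↦ φ(a
β(1))` gives `∑ φ(a x i) λ_{y i} = λ_a`; slicing the second by `β ↦ φ(β(1) a)` gives `ρ_a`. -/
theorem containsMultiplications_of_isWeakHopfSubalgebra (S : SeparableFrobeniusSystem F A)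
    {W : Subalgebra F (Module.End F A)} (hW : S.endWeakHopf.IsWeakHopfSubalgebra W) :
    ContainsMultiplications W := by
  obtain ⟨X, hX⟩ := (hW 1 W.one_mem).1
  replace hX : TensorProduct.map W.val.toLinearMap W.val.toLinearMap X = S.endComul 1 := hX
  rw [endComul_one] at hX
  refine ⟨fun a => ?_, fun a => ?_⟩
  · have h1 : ∀ Y : W ⊗[F] W, TensorProduct.lid F _
        ((S.φ ∘ₗ LinearMap.mulLeft F a ∘ₗ LinearMap.applyₗ 1).rTensor _
          (TensorProduct.map W.val.toLinearMap W.val.toLinearMap Y)) ∈ W := by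
      intro Y
      induction Y using TensorProduct.induction_on with
      | zero => simp
      | tmul α β => simpa using W.smul_mem β.2 _
      | add Y Z hY hZ => simpa only [map_add] using add_mem hY hZ
    have h2 := h1 X
    rw [hX] at h2
    convert h2 using 1
    ext b
    have := congrArg (· * b) (S.sum_left a)
    simpa [Finset.sum_mul] using this.symm
  · have h1 : ∀ Y : W ⊗[F] W, TensorProduct.rid F _
        ((S.φ ∘ₗ LinearMap.mulRight F a ∘ₗ LinearMap.applyₗ 1).lTensor _
          (TensorProduct.map W.val.toLinearMap W.val.toLinearMap Y)) ∈ W := by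
      intro Y
      induction Y using TensorProduct.induction_on with
      | zero => simp
      | tmul α β => simpa using W.smul_mem α.2 _
      | add Y Z hY hZ => simpa only [map_add] using add_mem hY hZ
    have h2 := h1 X
    rw [hX] at h2
    convert h2 using 1
    ext b
    have := congrArg (b * ·) (S.sum_right a)
    simpa [Finset.mul_sum] using this.symm

end SeparableFrobeniusSystem

/-! ## Existence of separable Frobenius systems -/

section Existence

/-- A simple finite-dimensional algebra has a functional whose kernel contains no nonzero left
ideal. -/
theorem exists_functional_of_isSimpleRing (F A : Type*) [Field F] [Ring A] [Algebra F A]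
    [FiniteDimensional F A] [IsSimpleRing A] :
    ∃ φ : A →ₗ[F] F, ∀ a, (∀ b, φ (b * a) = 0) → a = 0 := by
  have := IsArtinianRing.of_finite F A
  obtain ⟨n, _, D, _, _, _, ⟨e⟩⟩ :=
    IsSimpleRing.exists_algEquiv_matrix_divisionRing_finite F A
  -- Any functional on `D` with `ψ 1 ≠ 0` will do; the functional on `A` is `ψ` of the matrix trace.
  obtain ⟨ψ, hψ, -⟩ := Submodule.exists_le_ker_of_notMem
    (p := (⊥ : Submodule F D)) (v := 1) (by simp)
  refine ⟨ψ ∘ₗ Matrix.traceLinearMap (Fin n) F D ∘ₗ e.toLinearMap, fun a ha => ?_⟩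
  refine e.injective (Matrix.ext fun i j => ?_)
  by_contra hne
  rw [map_zero, Matrix.zero_apply] at hne
  -- This matrix unit moves the nonzero entry to the diagonal and scales it to 1, so the product has
  -- trace 1.
  have := ha (e.symm (Matrix.single j i (e a i j)⁻¹))
  simp [Matrix.trace_single_mul, hne, hψ] at this

/-- An off-diagonal `E_ij(d)` is the difference of the units `1 + E_ij(d)` and 1. A diagonal
`E_ii(d)` appears on expanding `(1 + E_ij(d))(1 + E_ji(1))`, unless the matrices are 1 × 1, where a
nonzero one is itself a unit. -/
theorem Matrix.mem_span_units (F : Type*) {n D : Type*} [Field F] [DivisionRing D] [Algebra F D]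
    [Fintype n] [DecidableEq n] (M : Matrix n n D) :
    M ∈ Submodule.span F {a : Matrix n n D | IsUnit a} := by
  have hunit : ∀ {i j : n}, i ≠ j → ∀ d : D, IsUnit (1 + Matrix.single i j d) := fun hij d =>
    IsNilpotent.isUnit_one_add ⟨2, by rw [pow_two, Matrix.single_mul_single_of_ne _ _ _ _ hij.symm]⟩
  have hspan : ∀ {a : Matrix n n D}, IsUnit a →
      a ∈ Submodule.span F {a : Matrix n n D | IsUnit a} := fun h => Submodule.subset_span h
  have hoff : ∀ {i j : n}, i ≠ j → ∀ d : D,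
      Matrix.single i j d ∈ Submodule.span F {a : Matrix n n D | IsUnit a} := fun hij d => by
    simpa using sub_mem (hspan (hunit hij d)) (hspan isUnit_one)
  induction M using Matrix.induction_on' with
  | h_zero => exact zero_mem _
  | h_add M N hM hN => exact add_mem hM hN
  | h_std_basis i j d =>
    by_cases hij : i = j
    · subst hij
      by_cases h : ∃ j, i ≠ j
      · obtain ⟨j, hj⟩ := h
        have : Matrix.single i i d = (1 + Matrix.single i j d) * (1 + Matrix.single j i 1)
            - 1 - Matrix.single i j d - Matrix.single j i 1 := by
          simp only [mul_add, add_mul, mul_one, one_mul, Matrix.single_mul_single_same]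
          abel
        rw [this]
        exact sub_mem (sub_mem (sub_mem (hspan ((hunit hj d).mul (hunit hj.symm 1)))
          (hspan isUnit_one)) (hoff hj d)) (hoff hj.symm 1)
      · push Not at h
        by_cases hd : d = 0
        · simp [hd]
        · have h1 : (1 : Matrix n n D) = Matrix.single i i 1 := by
            ext k l
            rw [← h k, ← h l]
            simp
          refine hspan ⟨⟨Matrix.single i i d, Matrix.single i i d⁻¹, ?_, ?_⟩, rfl⟩ <;>
            simp [h1, hd]
    · exact hoff hij d

/-- A simple finite-dimensional algebra is spanned by its units. -/
theorem span_units_of_isSimpleRing (F A : Type*) [Field F] [Ring A] [Algebra F A]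
    [FiniteDimensional F A] [IsSimpleRing A] :
    Submodule.span F {a : A | IsUnit a} = ⊤ := by
  have := IsArtinianRing.of_finite F A
  obtain ⟨n, _, D, _, _, _, ⟨e⟩⟩ :=
    IsSimpleRing.exists_algEquiv_matrix_divisionRing_finite F A
  have h : Submodule.span F {a : Matrix (Fin n) (Fin n) D | IsUnit a} ≤
      (Submodule.span F {a : A | IsUnit a}).comap e.symm.toLinearMap :=
    Submodule.span_le.2 fun a ha => Submodule.subset_span (IsUnit.map e.symm ha)
  refine Submodule.eq_top_iff'.2 fun a => ?_
  simpa using h (Matrix.mem_span_units F (e a))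

/-! ### Dual bases and their normalisation -/

variable {F A : Type*} [Field F] [Ring A] [Algebra F A]

/-- The form `φ(ab)` is nondegenerate. Take a basis `x` and the dual basis `y` with `φ(y i * x j) =
δ_ij`; the form need not be symmetric, so the two expansions are separate: one in `y`, one in `x`.
-/
theorem exists_frobenius_dualBases [FiniteDimensional F A] {φ : A →ₗ[F] F}
    (hφ : ∀ a, (∀ b, φ (b * a) = 0) → a = 0) :
    ∃ (n : ℕ) (x y : Fin n → A), (∀ a, ∑ i, φ (a * x i) • y i = a) ∧
      ∀ a, ∑ i, φ (y i * a) • x i = a := by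
  let B : LinearMap.BilinForm F A := (LinearMap.mul F A).compr₂ φ
  have hB : B.Nondegenerate :=
    LinearMap.BilinForm.Nondegenerate.ofSeparatingRight hφ
  let b := Module.finBasis F A
  refine ⟨_, b, B.dualBasis hB b, fun a => ?_, fun a => ?_⟩
  · conv_rhs => rw [← (B.dualBasis hB b).sum_repr a]
    simp only [LinearMap.BilinForm.dualBasis_repr_apply]
    rfl
  · have h : ∀ i, φ (B.dualBasis hB b i * a) = b.repr a i := fun i => by
      have : φ ∘ₗ LinearMap.mulLeft F (B.dualBasis hB b i) = b.coord i := b.ext fun j => by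
        have := B.apply_dualBasis_left hB b i j
        simpa [B, Finsupp.single_apply] using this
      exact LinearMap.congr_fun this a
    simp only [h, b.sum_repr]

/-- The map `c ↦ ∑ i, x i c y i`. -/
def sandwich {n : ℕ} (x y : Fin n → A) : A →ₗ[F] A :=
  ∑ i, LinearMap.mulRight F (y i) ∘ₗ LinearMap.mulLeft F (x i)

theorem sandwich_apply {n : ℕ} (x y : Fin n → A) (c : A) :
    sandwich (F := F) x y c = ∑ i, x i * c * y i := by
  simp [sandwich]

/-- Expanding `a x i` in the `x j`, or `y j a` in the `y i`, produces the same coefficients `φ(y j a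
x i)`. Hence the values of `sandwich` are central. -/
theorem mul_sandwich {n : ℕ} {φ : A →ₗ[F] F} {x y : Fin n → A}
    (hl : ∀ a, ∑ i, φ (a * x i) • y i = a) (hr : ∀ a, ∑ i, φ (y i * a) • x i = a) (a c : A) :
    a * sandwich (F := F) x y c = sandwich (F := F) x y c * a := by
  have h1 : ∀ i, a * x i * c * y i = ∑ j, φ (y j * a * x i) • (x j * c * y i) := fun i => by
    conv_lhs => rw [← hr (a * x i)]
    simp [Finset.sum_mul, mul_assoc]
  have h2 : ∀ j, x j * c * (y j * a) = ∑ i, φ (y j * a * x i) • (x j * c * y i) := fun j => by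
    conv_lhs => rw [← hl (y j * a)]
    simp [Finset.mul_sum]
  rw [sandwich_apply, Finset.mul_sum, Finset.sum_mul]
  refine (Finset.sum_congr rfl fun i _ => ?_).trans ((Finset.sum_comm
    (f := fun i j => φ (y j * a * x i) • (x j * c * y i))).trans
      (Finset.sum_congr rfl fun j _ => ?_))
  · rw [← h1]
    simp only [mul_assoc]
  · rw [← h2]
    simp only [mul_assoc]

/-- With `e = ∑ u ⊗ v`, the relation `ae = ea` turns `∑ x i φ(u) v y i` into `∑ x i φ(y i u) v = ∑ u
v`. For a separability idempotent this shows that 1 is a value of `sandwich`. -/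
theorem sandwich_eq_mul {n : ℕ} {φ : A →ₗ[F] F} {x y : Fin n → A}
    (hr : ∀ a, ∑ i, φ (y i * a) • x i = a) {e : A ⊗[F] A}
    (he : ∀ a : A, (LinearMap.mulLeft F a).rTensor A e = (LinearMap.mulRight F a).lTensor A e) :
    sandwich (F := F) x y (TensorProduct.lid F A (φ.rTensor A e)) = LinearMap.mul' F A e := by
  have h1 : ∀ (b : A) (Y : A ⊗[F] A), TensorProduct.lid F A (φ.rTensor A Y) * b =
      TensorProduct.lid F A (φ.rTensor A ((LinearMap.mulRight F b).lTensor A Y)) := by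
    intro b Y
    induction Y using TensorProduct.induction_on with
    | zero => simp
    | tmul u v => simp
    | add Y Z hY hZ => simp only [map_add, add_mul, hY, hZ]
  have h2 : ∀ Y : A ⊗[F] A, ∑ i, x i *
      TensorProduct.lid F A (φ.rTensor A ((LinearMap.mulLeft F (y i)).rTensor A Y)) =
        LinearMap.mul' F A Y := by
    intro Y
    induction Y using TensorProduct.induction_on with
    | zero => simp
    | tmul u v =>
      have := congrArg (· * v) (hr u)
      simpa [Finset.sum_mul] using this
    | add Y Z hY hZ => simp only [map_add, mul_add, Finset.sum_add_distrib, hY, hZ]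
  rw [sandwich_apply, ← h2]
  simp only [mul_assoc, h1, he]

theorem exists_separableFrobeniusSystem [FiniteDimensional F A] [IsSimpleRing A]
    (h : IsSeparableAlgebra F A) : Nonempty (SeparableFrobeniusSystem F A) := by
  obtain ⟨e, he, he1⟩ := h
  obtain ⟨φ, hφ⟩ := exists_functional_of_isSimpleRing F A
  obtain ⟨n, x, y, hl, hr⟩ := exists_frobenius_dualBases hφ
  -- The element at which `sandwich` takes the value 1 need not be invertible, but twisting `φ`
  -- requires a unit. Since units span `A`, `sandwich` is nonzero at one of them.
  obtain ⟨c, hc⟩ : ∃ c : Aˣ, sandwich (F := F) x y c ≠ 0 := by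
    by_contra! hker
    have h0 : Submodule.span F {a : A | IsUnit a} ≤ LinearMap.ker (sandwich (F := F) x y) :=
      Submodule.span_le.2 fun _ ⟨c, hc⟩ => hc ▸ hker c
    rw [span_units_of_isSimpleRing] at h0
    have := h0 (x := TensorProduct.lid F A (φ.rTensor A e)) trivial
    rw [LinearMap.mem_ker, sandwich_eq_mul hr he, he1] at this
    exact one_ne_zero this
  obtain ⟨⟨w, hw⟩, hzw⟩ := (IsSimpleRing.isField_center A).mul_inv_cancel
    (a := ⟨sandwich (F := F) x y c, Subring.mem_center_iff.2 fun a => mul_sandwich hl hr a c⟩)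
    (fun h => hc (congrArg Subtype.val h))
  have hzw : sandwich (F := F) x y c * w = 1 := congrArg Subtype.val hzw
  have hw := Subring.mem_center_iff.1 hw
  have hwz : w * sandwich (F := F) x y c = 1 := by rw [← hw, hzw]
  -- `w` is the inverse of the central value `sandwich x y c`, so `d` is the inverse of `c * w`.
  let d : A := sandwich (F := F) x y c * ↑c⁻¹
  have hcd : (c * w : A) * d = 1 := by
    simp only [d]
    rw [mul_assoc, ← mul_assoc w, hwz, one_mul, Units.mul_inv]
  have hdc : d * (c * w : A) = 1 := by
    simp only [d]
    rw [mul_assoc, Units.inv_mul_cancel_left, hzw]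
  -- Twisting `φ` by `d` cancels the factor `c * w` in the new `x i`, so the dual basis identities
  -- survive, while `∑ x i c w y i` becomes `sandwich x y c * w = 1`.
  refine ⟨⟨n, φ ∘ₗ LinearMap.mulRight F d, fun i => x i * (c * w), y, fun a => ?_, fun a => ?_, ?_⟩⟩
  · simpa [mul_assoc, hcd] using hl a
  · have := congrArg (· * (c * w : A)) (hr (a * d))
    simpa [Finset.sum_mul, mul_assoc, hdc] using this
  · rw [← hzw, sandwich_apply, Finset.sum_mul]
    exact Finset.sum_congr rfl fun i _ => by
      rw [← mul_assoc, mul_assoc _ w, ← hw, mul_assoc (x i * c)]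

end Existence

/-! ### The two Galois correspondences -/

theorem corollary7p4 {F A : Type*} [Field F] [Ring A] [Algebra F A] [FiniteDimensional F A]
    [IsSimpleRing A] :
    -- intermediate fields `F ⊆ E ⊆ Z(A)` and sub-`A`-bialgebroids of `End A_F`
    (∃ Γ : CentralIntermediateField F A ≃o
        {W : Subalgebra F (Module.End F A) // (endBialgebroid F A).IsSubBialgebroid W}ᵒᵈ,
      (∀ E, (OrderDual.ofDual (Γ E)).1 = galEnd E.1) ∧
      (∀ W, ((Γ.symm (OrderDual.toDual W)).1 : Set A) = fixSet W.1) ∧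
      (∀ W, ((Γ.symm (OrderDual.toDual W)).1).map (Algebra.lmul F A) =
        Subalgebra.centralizer F (W.1 : Set (Module.End F A)))) ∧
    -- the separable case: intermediate fields and weak Hopf subalgebras of `End A_F`
    (IsSeparableAlgebra F A →
      Nonempty (SeparableFrobeniusSystem F A) ∧
      ∀ S : SeparableFrobeniusSystem F A,
        ∃ Γ : CentralIntermediateField F A ≃o
            {W : Subalgebra F (Module.End F A) // S.endWeakHopf.IsWeakHopfSubalgebra W}ᵒᵈ,
          (∀ E, (OrderDual.ofDual (Γ E)).1 = galEnd E.1) ∧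
          (∀ W, ((Γ.symm (OrderDual.toDual W)).1 : Set A) = fixSet W.1) ∧
          (∀ W, ((Γ.symm (OrderDual.toDual W)).1).map (Algebra.lmul F A) =
            Subalgebra.centralizer F (W.1 : Set (Module.End F A)))) := by
  exact ⟨exists_orderIso_centralIntermediateField _ (fun _ => isSubBialgebroid_galEnd)
      fun _ => LeftBialgebroid.IsSubBialgebroid.containsMultiplications,
    fun h => ⟨exists_separableFrobeniusSystem h, fun S =>
      exists_orderIso_centralIntermediateField _ (fun _ => S.isWeakHopfSubalgebra_galEnd)
        fun _ => S.containsMultiplications_of_isWeakHopfSubalgebra⟩⟩
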